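/- Let $H(x,y)=\frac12y^2+\frac12x^2+\frac14x^4$. Let $\lambda_1(\varepsilon),\dots,\lambda_6(\varepsilon)$ be real functions, analytic at $\varepsilon=0$, with $\lambda_j(\varepsilon)=\sum_{k\ge1}\lambda_{jk}\varepsilon^k$ near $0$ (so $\lambda_j(0)=0$), and consider the planar system $$X_{\lambda(\varepsilon)}:\quad \dot x=y,\qquad \dot y=-x-x^3+\bigl(\lambda_1+\lambda_2x^2+\lambda_3y^2+\lambda_4x^4+\lambda_5y^4+\lambda_6x^6\bigr)y ,$$ with $\lambda_j=\lambda_j(\varepsilon)$. Let $\sigma:(0,\infty)\to\mathbb R^2$ be an analytic cross section of the period annulus $\{H=h\}$, $h>0$, of $X_0$, parametrised by the level, i.e. $H(\sigma(h))=h$. Let $P(h,\varepsilon)$ be the first return map of $X_{\lambda(\varepsilon)}$: the trajectory starting at $\sigma(h)$ meets the cross section again for the first time at $\sigma(P(h,\varepsilon))$. Let $d(h,\varepsilon)=P(h,\varepsilon)-h$ be the displacement function. Let $$I_0(h)=\oint_{H=h}y\,dx,\qquad I_2(h)=\oint_{H=h}x^2y\,dx,$$ where the oval $\{H=h\}$ is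 oriented by the flow of $X_0$ (clockwise). Then for every $h_0>0$ the first return exists and is unique for $(h,\varepsilon)$ near $(h_0,0)$, and $d$ is analytic there, so that for each $h>0$ $$d(h,\varepsilon)=M_1(h)\varepsilon+M_2(h)\varepsilon^2+\cdots$$ for small $\varepsilon$. Let $n\ge1$ be such that $M_k(h)=0$ for all $1\le k<n$ and all $h>0$ (in particular, $M_n$ may be the first coefficient that does not vanish identically). Put $$\begin{aligned}L_n(h)={}&\Bigl[\bigl(\tfrac43\lambda_{6n}-\tfrac{320}{231}\lambda_{5n}\bigr)h+\bigl(\tfrac{32}{21}\lambda_{6n}-\tfrac{40}{231}\lambda_{5n}-\tfrac87\lambda_{4n}-\tfrac37\lambda_{3n}+\lambda_{2n}\bigr)\Bigr]I_2(h)\\&+\Bigl[\tfrac{240}{77}\lambda_{5n}h^2+\bigl(-\tfrac{16}{21}\lambda_{6n}+\tfrac{20}{231}\lambda_{5n}+\tfrac47\lambda_{4n}+\tfrac{12}{7}\lambda_{3n}\bigr)h+\lambda_{1n}\Bigr]I_0(h).\end{aligned}$$ Then for every $h>0$: if $n=3m$ with $m\in\mathbb N$, then $$M_n(h)=L_n(h)+\tfrac{8}{1001}\lambda_{3m}^3\bigl[-(308h^2+181h+24)I_2(h)+(80h^2+12h)I_0(h)\bigr],$$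 where $\lambda_{3m}$ is the coefficient of $\varepsilon^m$ in $\lambda_3(\varepsilon)$; and if $n$ is not a multiple of $3$, then $M_n(h)=L_n(h)$. -/

import Mathlib

open Filter Topology Set

noncomputable section

namespace GlobalCenter

/-- The Hamiltonian `H = y²/2 + x²/2 + x⁴/4`. -/
def H (p : ℝ × ℝ) : ℝ := p.2 ^ 2 / 2 + p.1 ^ 2 / 2 + p.1 ^ 4 / 4

/-- The coefficient `λ₁ + λ₂ x² + λ₃ y² + λ₄ x⁴ + λ₅ y⁴ + λ₆ x⁶` of the perturbation.
The parameters `λ₁, …, λ₆` are `l 0, …, l 5`. -/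
def pert (l : Fin 6 → ℝ) (p : ℝ × ℝ) : ℝ :=
  l 0 + l 1 * p.1 ^ 2 + l 2 * p.2 ^ 2 + l 3 * p.1 ^ 4 + l 4 * p.2 ^ 4 + l 5 * p.1 ^ 6

/-- The vector field `X_λ`: `ẋ = H_y = y`,
`ẏ = -H_x + (λ₁ + λ₂ x² + λ₃ y² + λ₄ x⁴ + λ₅ y⁴ + λ₆ x⁶) y`, where `H_x = x + x³`. -/
def X (l : Fin 6 → ℝ) (p : ℝ × ℝ) : ℝ × ℝ :=
  (p.2, -(p.1 + p.1 ^ 3) + pert l p * p.2)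

/-- An analytic cross section of the period annulus `{H = h}, h > 0`, parametrised by the
value `h` of the Hamiltonian. -/
structure IsCrossSection (σ : ℝ → ℝ × ℝ) : Prop where
  analytic : AnalyticOnNhd ℝ σ (Ioi 0)
  level : ∀ h, 0 < h → H (σ h) = h

/-- The trajectory of `X_λ` which starts at the point `σ h` of the cross section
meets the cross section again, for the first time, at the point `σ h'`. -/
def IsFirstReturn (l : Fin 6 → ℝ) (σ : ℝ → ℝ × ℝ) (h h' : ℝ) : Prop :=
  0 < h' ∧ ∃ (T : ℝ) (γ : ℝ → ℝ × ℝ), 0 < T ∧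
    IsIntegralCurveOn γ (fun _ => X l) (Icc 0 T) ∧
    γ 0 = σ h ∧ γ T = σ h' ∧ ∀ t ∈ Ioo 0 T, γ t ∉ σ '' Ioi 0

open Classical in
/-- The displacement function `d(h, ε) = P(h, ε) - h` of the deformation `X_{λ(ε)}`, where
`P` is the first return map on the cross section `σ` (it is `0` where there is no return). -/
def displacement (lam : Fin 6 → ℝ → ℝ) (σ : ℝ → ℝ × ℝ) (h ε : ℝ) : ℝ :=
  if hr : ∃ h', IsFirstReturn (fun j => lam j ε) σ h h' then hr.choose - h else 0

/-- The coefficient of `ε ^ k` in the Taylor series of `f` at `0`. -/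
def taylorCoeff (f : ℝ → ℝ) (k : ℕ) : ℝ := iteratedDeriv k f 0 / (k.factorial : ℝ)

/-- `M_k(h)`, the coefficient of `ε ^ k` in the expansion of the displacement function. -/
def M (lam : Fin 6 → ℝ → ℝ) (σ : ℝ → ℝ × ℝ) (k : ℕ) (h : ℝ) : ℝ :=
  taylorCoeff (displacement lam σ h) k

/-- The right end `a` of the projection `[-a, a]` of the oval `{H = h}` to the `x`-axis. -/
def xMax (h : ℝ) : ℝ := √(-1 + √(1 + 4 * h))

/-- The oval `{H = h}` is the union of the two graphs `y = ± yPlus h x`, `|x| ≤ xMax h`. -/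
def yPlus (h x : ℝ) : ℝ := √(2 * h - x ^ 2 - x ^ 4 / 2)

/-- The integral of the one-form `g(x, y) dx` along the oval `{H = h}`, which is oriented
by the flow of `X₀`: to the right on the upper branch, then to the left on the lower one. -/
def ovalIntegral (g : ℝ → ℝ → ℝ) (h : ℝ) : ℝ :=
  (∫ x in (-xMax h)..(xMax h), g x (yPlus h x)) +
    ∫ x in (xMax h)..(-xMax h), g x (-yPlus h x)

/-- `I₀(h)`, the integral of `y dx` along `{H = h}`. -/
def I₀ (h : ℝ) : ℝ := ovalIntegral (fun _ y => y) h

/-- `I₂(h)`, the integral of `x² y dx` along `{H = h}`. -/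
def I₂ (h : ℝ) : ℝ := ovalIntegral (fun x y => x ^ 2 * y) h

/-- The part of the formula that is linear in the coefficients
`λ_{1n}, …, λ_{6n}`, which are here `c 0, …, c 5`. -/
def linearPart (c : Fin 6 → ℝ) (h : ℝ) : ℝ :=
  ((4 / 3 * c 5 - 320 / 231 * c 4) * h +
      (32 / 21 * c 5 - 40 / 231 * c 4 - 8 / 7 * c 3 - 3 / 7 * c 2 + c 1)) * I₂ h +
    (240 / 77 * c 4 * h ^ 2 +
      (-(16 / 21) * c 5 + 20 / 231 * c 4 + 4 / 7 * c 3 + 12 / 7 * c 2) * h + c 0) * I₀ h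

/-- The extra term, `s` being the coefficient of `ε ^ m` in `λ₃(ε)`. -/
def cubicPart (s h : ℝ) : ℝ :=
  8 / 1001 * s ^ 3 *
    (-(308 * h ^ 2 + 181 * h + 24) * I₂ h + (80 * h ^ 2 + 12 * h) * I₀ h)

end GlobalCenter

end

noncomputable section

namespace GlobalCenter

open scoped ContDiff

/-! Along `X_λ` one has `dH = pert · y dx`, so to first order the displacement is the integral of
`pert · y dx` over the oval. `integral_pert` reduces it modulo exact forms to `linearPart`, whose
kernel is the line spanned by `nullDir`. In that direction the form is `η = dg - 3xy dH` with `g =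
xy³`, so its integral over every oval vanishes. As in Françoise's algorithm, `-3xy η = dG + S dH`
with `S = secondDensity`, so the second order vanishes as well, and the third order is the integral
of `S η`, which `integral_secondDensity` evaluates to `cubicPart 1`.

These reductions are packed into one exact identity. Put `μ = λ₃` and split `λ = μ nullDir + δ`. The
corrected energy `H - μ g - μ² G` changes along a trajectory by `μ³` times a limit-controlled
integral plus terms linear in `δ` (`hasDerivWithinAt_correctedEnergy`, `correctedEnergy_sub`).
Comparing both ends of a turn and dividing by `εⁿ` gives the leading term of the displacement
(`tendsto_displacement_div_pow`), provided that `δ` and `μ³` are of order at least `n`.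

That proviso follows by induction from the vanishing of the earlier `M_k`
(`taylorCoeff_of_M_eq_zero`): `I₀` and `I₂` are independent over polynomials of degree two
(`basic_integrals_independent`), hence a vanishing leading term forces its `δ` coefficients and its
cubic coefficient to vanish.

Analyticity comes from two implicit function theorems. Trajectories are zeros of a polynomial map on
a Banach space, whose linearisation is the identity minus a Volterra operator
(`exists_analytic_flow`); the end on the section is then solved for by transversality
(`exists_analytic_return`). Compactness excludes earlier crossings (`eventually_no_early_return`).
-/

/-- Pairs of continuous functions on the unit interval, that is, paths in the plane. -/
abbrev PathPair : Type := C(unitInterval, ℝ) × C(unitInterval, ℝ)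

/-! ### Volterra operators on the space of paths. -/

/-- Primitive of a continuous function on the unit interval, vanishing at `0`. -/
def primitive : C(unitInterval, ℝ) →L[ℝ] C(unitInterval, ℝ) :=
  LinearMap.mkContinuous
    { toFun := fun f =>
        { toFun := fun t => ∫ s in (0 : ℝ)..t, IccExtend (zero_le_one (α := ℝ)) f s
          continuous_toFun := by
            have hc : Continuous (IccExtend (zero_le_one (α := ℝ)) f) := f.continuous.Icc_extend'
            exact (intervalIntegral.continuous_primitive
              (fun a b => hc.intervalIntegrable a b) 0).comp continuous_subtype_val }
      map_add' := by
        intro f g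
        ext t
        have hf : Continuous (IccExtend (zero_le_one (α := ℝ)) f) := f.continuous.Icc_extend'
        have hg : Continuous (IccExtend (zero_le_one (α := ℝ)) g) := g.continuous.Icc_extend'
        simp only [ContinuousMap.coe_mk, ContinuousMap.add_apply]
        rw [← intervalIntegral.integral_add (hf.intervalIntegrable _ _)
          (hg.intervalIntegrable _ _)]
        rfl
      map_smul' := by
        intro c f
        ext t
        simp only [ContinuousMap.coe_mk, ContinuousMap.smul_apply, RingHom.id_apply, smul_eq_mul]
        rw [← intervalIntegral.integral_const_mul]
        rfl } 1 (by
    intro f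
    rw [one_mul, ContinuousMap.norm_le _ (norm_nonneg f)]
    intro t
    have := intervalIntegral.norm_integral_le_of_norm_le_const
      (a := (0 : ℝ)) (b := t) (f := IccExtend (zero_le_one (α := ℝ)) f) (C := ‖f‖)
      (fun s _ => f.norm_coe_le_norm _)
    refine this.trans ?_
    rw [sub_zero, abs_of_nonneg t.2.1]
    exact mul_le_of_le_one_right (norm_nonneg f) t.2.2)

lemma primitive_apply (f : C(unitInterval, ℝ)) (t : unitInterval) :
    primitive f t = ∫ s in (0 : ℝ)..t, IccExtend (zero_le_one (α := ℝ)) f s := rfl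

/-- Each integration gains a power of `t` and a denominator; iterating this produces the factorial
in `volterra_pow_apply_le`. -/
lemma abs_primitive_le {f : C(unitInterval, ℝ)} {c : ℝ} {n : ℕ}
    (hf : ∀ t : unitInterval, |f t| ≤ c * (t : ℝ) ^ n) (t : unitInterval) :
    |primitive f t| ≤ c / (n + 1) * (t : ℝ) ^ (n + 1) := by
  have hc : Continuous (IccExtend (zero_le_one (α := ℝ)) f) := f.continuous.Icc_extend'
  have h1 : ‖∫ s in (0 : ℝ)..t, IccExtend (zero_le_one (α := ℝ)) f s‖ ≤
      ∫ s in (0 : ℝ)..t, c * s ^ n := by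
    apply intervalIntegral.norm_integral_le_of_norm_le t.2.1
    · refine Eventually.of_forall fun s hs => ?_
      have hs' : s ∈ Icc (0 : ℝ) 1 := ⟨hs.1.le, hs.2.trans t.2.2⟩
      rw [IccExtend_of_mem _ _ hs']
      exact hf ⟨s, hs'⟩
    · exact (continuous_const.mul (continuous_pow n)).intervalIntegrable _ _
  rw [primitive_apply]
  refine h1.trans (le_of_eq ?_)
  rw [intervalIntegral.integral_const_mul, integral_pow]
  field_simp
  simp

/-- A Volterra operator: composition of a pointwise bounded operator and the primitive. -/
def volterra (B : PathPair →L[ℝ] PathPair) :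
    PathPair →L[ℝ] PathPair :=
  (primitive.prodMap primitive) ∘L B

lemma volterra_pow_apply_le {B : PathPair →L[ℝ] PathPair} {c : ℝ}
    (hB : ∀ (η : PathPair) (t : unitInterval) (b : ℝ), |η.1 t| ≤ b → |η.2 t| ≤ b →
      |(B η).1 t| ≤ c * b ∧ |(B η).2 t| ≤ c * b)
    (η : PathPair) (n : ℕ) (t : unitInterval) :
    |((volterra B ^ n) η).1 t| ≤ c ^ n * ‖η‖ / n.factorial * (t : ℝ) ^ n ∧
      |((volterra B ^ n) η).2 t| ≤ c ^ n * ‖η‖ / n.factorial * (t : ℝ) ^ n := by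
  induction n generalizing t with
  | zero =>
    simp only [pow_zero, one_mul, Nat.factorial_zero, Nat.cast_one, div_one, mul_one]
    exact ⟨(η.1.norm_coe_le_norm t).trans (norm_fst_le η),
      (η.2.norm_coe_le_norm t).trans (norm_snd_le η)⟩
  | succ n ih =>
    have key : c * (c ^ n * ‖η‖ / n.factorial) / (n + 1) =
        c ^ (n + 1) * ‖η‖ / (n + 1).factorial := by
      rw [Nat.factorial_succ]
      push_cast
      field_simp
      ring
    have h := fun s : unitInterval => hB ((volterra B ^ n) η) s _ (ih s).1 (ih s).2
    rw [pow_succ', ← key]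
    constructor
    · exact abs_primitive_le (fun s => (h s).1.trans_eq (by ring)) t
    · exact abs_primitive_le (fun s => (h s).2.trans_eq (by ring)) t

/-- `1 - K` is invertible for a Volterra operator `K`. -/
lemma isUnit_one_sub_volterra {B : PathPair →L[ℝ] PathPair} {c : ℝ}
    (hc : 0 ≤ c)
    (hB : ∀ (η : PathPair) (t : unitInterval) (b : ℝ), |η.1 t| ≤ b → |η.2 t| ≤ b →
      |(B η).1 t| ≤ c * b ∧ |(B η).2 t| ≤ c * b) :
    IsUnit (1 - volterra B) := by
  -- Only some power of the operator needs to be a contraction: `1 - Kⁿ` factors through `1 - K`,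
  -- and a commuting factor of a unit is a unit.
  obtain ⟨n, hn⟩ : ∃ n : ℕ, c ^ n / n.factorial < 1 :=
    ((FloorSemiring.tendsto_pow_div_factorial_atTop c).eventually_lt_const one_pos).exists
  have hbound : ‖volterra B ^ n‖ ≤ c ^ n / n.factorial := by
    refine ContinuousLinearMap.opNorm_le_bound _ (by positivity) fun η => ?_
    have hle : ∀ t : unitInterval,
        c ^ n * ‖η‖ / n.factorial * (t : ℝ) ^ n ≤ c ^ n / n.factorial * ‖η‖ := by
      intro t
      have := pow_le_one₀ (n := n) t.2.1 t.2.2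
      calc c ^ n * ‖η‖ / n.factorial * (t : ℝ) ^ n ≤ c ^ n * ‖η‖ / n.factorial * 1 := by gcongr
        _ = _ := by ring
    refine max_le ?_ ?_
    · exact (ContinuousMap.norm_le _ (by positivity)).2 fun t =>
        (volterra_pow_apply_le hB η n t).1.trans (hle t)
    · exact (ContinuousMap.norm_le _ (by positivity)).2 fun t =>
        (volterra_pow_apply_le hB η n t).2.trans (hle t)
  have hu : IsUnit (1 - volterra B ^ n) :=
    (Units.oneSub (volterra B ^ n) (hbound.trans_lt hn)).isUnit
  rw [← mul_neg_geom_sum] at hu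
  have hcomm : Commute (1 - volterra B) (∑ i ∈ Finset.range n, volterra B ^ i) :=
    Commute.sum_right _ _ _ fun i _ =>
      ((Commute.one_left _).sub_left (Commute.refl _)).pow_right i
  exact (hcomm.isUnit_mul_iff.1 hu).1

/-! ### Trajectories as zeros of an analytic map. -/

/-- The vector field `X_l` acting on pairs of continuous functions. -/
def fieldOn (l : Fin 6 → ℝ) (γ : PathPair) : PathPair :=
  (γ.2, -(γ.1 + γ.1 ^ 3) + (l 0 • (1 : C(unitInterval, ℝ)) + l 1 • γ.1 ^ 2 + l 2 • γ.2 ^ 2 +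
    l 3 • γ.1 ^ 4 + l 4 • γ.2 ^ 4 + l 5 • γ.1 ^ 6) * γ.2)

lemma fieldOn_apply (l : Fin 6 → ℝ) (γ : PathPair) (t : unitInterval) :
    ((fieldOn l γ).1 t, (fieldOn l γ).2 t) = X l (γ.1 t, γ.2 t) := by
  simp [fieldOn, X, pert]

/-- The defect of the integral equation `γ = ξ + T ∫ X_l(γ)`, with parameters `p = (T, ξ, l)`. -/
def defect (u : (ℝ × (ℝ × ℝ) × (Fin 6 → ℝ)) × PathPair) : PathPair :=
  (u.2.1 - u.1.2.1.1 • (1 : C(unitInterval, ℝ)) - u.1.1 • primitive (fieldOn u.1.2.2 u.2).1,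
    u.2.2 - u.1.2.1.2 • (1 : C(unitInterval, ℝ)) - u.1.1 • primitive (fieldOn u.1.2.2 u.2).2)

/-- The field is polynomial and `C([0,1])` is a Banach algebra, so `defect` is built from products
and one continuous linear map. Keeping the duration `T` as a parameter fixes the interval. -/
lemma contDiff_defect : ContDiff ℝ ω defect := by
  unfold defect fieldOn
  fun_prop

/-- The linearisation of `γ ↦ T X_0(γ)` at `γ₀`. -/
def linField (T : ℝ) (x : C(unitInterval, ℝ)) :
    PathPair →L[ℝ] PathPair :=
  (T • ContinuousLinearMap.snd ℝ C(unitInterval, ℝ) C(unitInterval, ℝ)).prod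
    (-(T • (ContinuousLinearMap.mul ℝ C(unitInterval, ℝ) (1 + 3 * x ^ 2)) ∘L
      ContinuousLinearMap.fst ℝ C(unitInterval, ℝ) C(unitInterval, ℝ)))

lemma linField_bound (T : ℝ) (x : C(unitInterval, ℝ)) (η : PathPair) (t : unitInterval) (b : ℝ)
    (h1 : |η.1 t| ≤ b) (h2 : |η.2 t| ≤ b) :
    |(linField T x η).1 t| ≤ |T| * ((1 + ‖1 + 3 * x ^ 2‖) * b) ∧
      |(linField T x η).2 t| ≤ |T| * ((1 + ‖1 + 3 * x ^ 2‖) * b) := by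
  have hb : 0 ≤ b := (abs_nonneg _).trans h1
  have e1 : (linField T x η).1 t = T * η.2 t := rfl
  have e2 : (linField T x η).2 t = -(T * ((1 + 3 * x ^ 2 : C(unitInterval, ℝ)) t * η.1 t)) := rfl
  have hx : |(1 + 3 * x ^ 2 : C(unitInterval, ℝ)) t| ≤ ‖1 + 3 * x ^ 2‖ := 
    (1 + 3 * x ^ 2 : C(unitInterval, ℝ)).norm_coe_le_norm t
  have hn := norm_nonneg (1 + 3 * x ^ 2)
  rw [e1, e2, abs_neg, abs_mul, abs_mul, abs_mul]
  constructor
  · gcongr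
    nlinarith
  · gcongr
    nlinarith [mul_le_mul hx h1 (abs_nonneg _) hn]

lemma hasFDerivAt_defect (T : ℝ) (ξ : ℝ × ℝ) (γ : PathPair) :
    HasFDerivAt (fun η => defect ((T, ξ, 0), η)) (1 - volterra (linField T γ.1)) γ := by
  have h1 : HasFDerivAt (fun η : PathPair => η.1)
    (ContinuousLinearMap.fst ℝ C(unitInterval, ℝ) C(unitInterval, ℝ)) γ := hasFDerivAt_fst
  have h2 : HasFDerivAt (fun η : PathPair => η.2)
    (ContinuousLinearMap.snd ℝ C(unitInterval, ℝ) C(unitInterval, ℝ)) γ := hasFDerivAt_snd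
  have h3 := (h1.add (h1.pow 3)).neg
  have h4 := (h1.sub_const (ξ.1 • (1 : C(unitInterval, ℝ)))).sub
    ((primitive.hasFDerivAt.comp γ h2).const_smul T)
  have h5 := (h2.sub_const (ξ.2 • (1 : C(unitInterval, ℝ)))).sub
    ((primitive.hasFDerivAt.comp γ h3).const_smul T)
  refine ((h4.prodMk h5).congr_of_eventuallyEq (Eventually.of_forall fun η => ?_)).congr_fderiv ?_
  · simp [defect, fieldOn]
  · refine ContinuousLinearMap.ext fun η => Prod.ext ?_ ?_
    · change η.1 - T • primitive η.2 = η.1 - primitive (T • η.2)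
      rw [map_smul]
    have e1 : ((1 - volterra (linField T γ.1)) η).2 =
      η.2 - primitive (-(T • ((1 + 3 * γ.1 ^ 2) * η.1))) := rfl
    rw [e1]
    change η.2 - T • primitive (-(η.1 + (3 • γ.1 ^ (3 - 1)) • η.1)) = _
    rw [← map_smul]
    congr 2
    ext t
    simp
    ring

/-- Analytic dependence of trajectories on the duration, the initial point and the parameters of
the perturbation, near a trajectory of the unperturbed system. -/
theorem exists_analytic_flow {T : ℝ} {ξ : ℝ × ℝ} {γ : PathPair}
    (h : defect ((T, ξ, 0), γ) = 0) :
    ∃ Γ : ℝ × (ℝ × ℝ) × (Fin 6 → ℝ) → PathPair,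
      AnalyticAt ℝ Γ (T, ξ, 0) ∧ Γ (T, ξ, 0) = γ ∧
      (∀ᶠ p in 𝓝 (T, ξ, (0 : Fin 6 → ℝ)), defect (p, Γ p) = 0) ∧
      ∀ᶠ u in 𝓝 ((T, ξ, (0 : Fin 6 → ℝ)), γ), defect u = 0 → Γ u.1 = u.2 := by
  have cd : ContDiffAt ℝ ω defect ((T, ξ, 0), γ) := contDiff_defect.contDiffAt
  have hω : (ω : WithTop ℕ∞) ≠ 0 := by simp
  have hcomp : HasFDerivAt (fun η => defect ((T, ξ, 0), η))
      (fderiv ℝ defect ((T, ξ, 0), γ) ∘L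
        .inr ℝ (ℝ × (ℝ × ℝ) × (Fin 6 → ℝ)) PathPair) γ :=
    (cd.differentiableAt hω).hasFDerivAt.comp γ (hasFDerivAt_prodMk_right _ _)
  have hinv : (fderiv ℝ defect ((T, ξ, 0), γ) ∘L
      .inr ℝ (ℝ × (ℝ × ℝ) × (Fin 6 → ℝ)) PathPair).IsInvertible := by
    rw [hcomp.unique (hasFDerivAt_defect T ξ γ)]
    obtain ⟨e, he⟩ : IsUnit (1 - volterra (linField T γ.1)) :=
      (isUnit_one_sub_volterra (c := |T| * (1 + ‖1 + 3 * γ.1 ^ 2‖)) (by positivity)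
        fun η t b h1 h2 => by
          rw [mul_assoc]
          exact linField_bound T γ.1 η t b h1 h2)
    exact ⟨ContinuousLinearEquiv.unitsEquiv ℝ _ e, he⟩
  refine ⟨cd.implicitFunction hω hinv, ?_, cd.implicitFunction_apply_self hω hinv, ?_, ?_⟩
  · exact (cd.contDiffAt_implicitFunction hω hinv).analyticAt
  · simpa only [h] using cd.eventually_apply_implicitFunction hω hinv
  · filter_upwards [cd.eventually_apply_eq_iff_implicitFunction hω hinv] with u hu h0
    -- This is the local uniqueness of the implicit function: any nearby solution of the integral
    -- equation is the one given by `Γ`.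
    exact hu.1 (h0.trans h.symm)

/-- The plane curve given by a pair of continuous functions on the unit interval. -/
def curve (γ : PathPair) (s : ℝ) : ℝ × ℝ :=
  (IccExtend (zero_le_one (α := ℝ)) γ.1 s, IccExtend (zero_le_one (α := ℝ)) γ.2 s)

lemma curve_of_mem (γ : PathPair) {s : ℝ} (hs : s ∈ Icc (0 : ℝ) 1) :
    curve γ s = (γ.1 ⟨s, hs⟩, γ.2 ⟨s, hs⟩) := by
  simp [curve, IccExtend_of_mem _ _ hs]

lemma continuous_curve_uncurry :
    Continuous fun u : PathPair × ℝ => curve u.1 u.2 := by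
  unfold curve IccExtend
  simp only [Function.comp_apply]
  have : Continuous (projIcc (0 : ℝ) 1 zero_le_one) := continuous_projIcc
  fun_prop

lemma continuous_curve (γ : PathPair) : Continuous (curve γ) :=
  continuous_curve_uncurry.comp (Continuous.prodMk_right γ)

lemma continuous_X : Continuous fun u : (Fin 6 → ℝ) × (ℝ × ℝ) => X u.1 u.2 := by
  unfold X pert
  fun_prop

lemma curve_fieldOn (l : Fin 6 → ℝ) (γ : PathPair) (s : ℝ) :
    curve (fieldOn l γ) s = X l (curve γ s) :=
  fieldOn_apply l γ (projIcc 0 1 zero_le_one s)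

lemma curve_zero_of_defect {T : ℝ} {ξ : ℝ × ℝ} {l : Fin 6 → ℝ} {γ : PathPair}
    (h : defect ((T, ξ, l), γ) = 0) : curve γ 0 = ξ := by
  have h1 := DFunLike.congr_fun (congrArg Prod.fst h) (0 : unitInterval)
  have h2 := DFunLike.congr_fun (congrArg Prod.snd h) (0 : unitInterval)
  rw [curve_of_mem γ (left_mem_Icc.2 zero_le_one)]
  simp [defect, primitive_apply] at h1 h2
  exact Prod.ext (sub_eq_zero.1 h1) (sub_eq_zero.1 h2)

lemma hasDerivWithinAt_curve {T : ℝ} {ξ : ℝ × ℝ} {l : Fin 6 → ℝ} {γ : PathPair}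
    (h : defect ((T, ξ, l), γ) = 0) {s : ℝ} (hs : s ∈ Icc (0 : ℝ) 1) :
    HasDerivWithinAt (curve γ) (T • X l (curve γ s)) (Icc 0 1) s := by
  have key : ∀ (f g : C(unitInterval, ℝ)) (a : ℝ),
      f - a • (1 : C(unitInterval, ℝ)) - T • primitive g = 0 →
      HasDerivWithinAt (IccExtend (zero_le_one (α := ℝ)) f)
        (T * IccExtend (zero_le_one (α := ℝ)) g s) (Icc 0 1) s := by
    intro f g a hfg
    have hc : Continuous (IccExtend (zero_le_one (α := ℝ)) g) := g.continuous.Icc_extend'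
    have hd : HasDerivAt
        (fun t => a + T * ∫ s in (0 : ℝ)..t, IccExtend (zero_le_one (α := ℝ)) g s)
        (T * IccExtend (zero_le_one (α := ℝ)) g s) s :=
      ((intervalIntegral.integral_hasDerivAt_right (hc.intervalIntegrable _ _)
        (hc.stronglyMeasurableAtFilter _ _) hc.continuousAt).const_mul T).const_add a
    have heq : ∀ t ∈ Icc (0 : ℝ) 1, IccExtend (zero_le_one (α := ℝ)) f t =
        a + T * ∫ s in (0 : ℝ)..t, IccExtend (zero_le_one (α := ℝ)) g s := by
      intro t ht
      have := DFunLike.congr_fun hfg (⟨t, ht⟩ : unitInterval)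
      simp [primitive_apply] at this
      rw [IccExtend_of_mem _ _ ht]
      linarith
    exact hd.hasDerivWithinAt.congr heq (heq s hs)
  have h1 := key _ _ _ (congrArg Prod.fst h)
  have h2 := key _ _ _ (congrArg Prod.snd h)
  have := h1.prodMk h2
  rw [← curve_fieldOn]
  exact this

/-- The restriction of `s ↦ c (T s)` to the unit interval. -/
def rescale (c : C(ℝ, ℝ × ℝ)) (T : ℝ) : PathPair :=
  (⟨fun s => (c (T * s)).1, by fun_prop⟩, ⟨fun s => (c (T * s)).2, by fun_prop⟩)

lemma continuous_rescale (c : C(ℝ, ℝ × ℝ)) : Continuous (rescale c) := by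
  refine Continuous.prodMk ?_ ?_
  · exact ContinuousMap.continuous_of_continuous_uncurry _ (by
      simp only [Function.uncurry_def, ContinuousMap.coe_mk]; fun_prop)
  · exact ContinuousMap.continuous_of_continuous_uncurry _ (by
      simp only [Function.uncurry_def, ContinuousMap.coe_mk]; fun_prop)

lemma curve_rescale (c : C(ℝ, ℝ × ℝ)) (T : ℝ) {s : ℝ} (hs : s ∈ Icc (0 : ℝ) 1) :
    curve (rescale c T) s = c (T * s) := by
  rw [curve_of_mem _ hs]
  rfl

/-- This feeds the explicit periodic orbit into the implicit function theorem, for every duration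
`T` and not only for the period. -/
lemma defect_rescale {c : C(ℝ, ℝ × ℝ)} {l : Fin 6 → ℝ}
    (hc : ∀ t, HasDerivAt c (X l (c t)) t) (T : ℝ) :
    defect ((T, c 0, l), rescale c T) = 0 := by
  have hX : Continuous fun t => X l (c t) :=
    continuous_X.comp (continuous_const.prodMk c.continuous)
  have key : ∀ (φ ψ : ℝ → ℝ), (∀ t, HasDerivAt φ (ψ t) t) → Continuous ψ →
      ∀ (f g : C(unitInterval, ℝ)), (∀ t : unitInterval, f t = φ (T * t)) →
        (∀ t : unitInterval, g t = ψ (T * t)) →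
      f - φ 0 • (1 : C(unitInterval, ℝ)) - T • primitive g = 0 := by
    intro φ ψ hφ hψ f g hf hg
    ext t
    have hd : ∀ s : ℝ, HasDerivAt (fun s => φ (T * s)) (T * ψ (T * s)) s := by
      intro s
      have := (hφ (T * s)).comp s ((hasDerivAt_id s).const_mul T)
      rw [mul_one, mul_comm] at this
      exact this
    have hi : ∫ s in (0 : ℝ)..t, T * ψ (T * s) = φ (T * t) - φ (T * 0) :=
      intervalIntegral.integral_eq_sub_of_hasDerivAt (fun s _ => hd s)
        ((by fun_prop : Continuous fun s => T * ψ (T * s)).intervalIntegrable _ _)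
    have hp : primitive g t = ∫ s in (0 : ℝ)..t, ψ (T * s) := by
      rw [primitive_apply]
      refine intervalIntegral.integral_congr fun s hs => ?_
      rw [uIcc_of_le t.2.1] at hs
      have hs' : s ∈ Icc (0 : ℝ) 1 := ⟨hs.1, hs.2.trans t.2.2⟩
      rw [IccExtend_of_mem _ _ hs', hg]
    rw [intervalIntegral.integral_const_mul, mul_zero] at hi
    simp only [ContinuousMap.sub_apply, ContinuousMap.smul_apply, ContinuousMap.one_apply,
      smul_eq_mul, mul_one, ContinuousMap.zero_apply, hf, hp]
    linarith
  refine Prod.ext ?_ ?_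
  · refine key (fun t => (c t).1) (fun t => (X l (c t)).1) (fun t => ?_) hX.fst _ _
      (fun _ => rfl) fun t => ?_
    · exact (hc t).fst
    · exact congrArg Prod.fst (fieldOn_apply l (rescale c T) t)
  · refine key (fun t => (c t).2) (fun t => (X l (c t)).2) (fun t => ?_) hX.snd _ _
      (fun _ => rfl) fun t => ?_
    · exact (hc t).snd
    · exact congrArg Prod.snd (fieldOn_apply l (rescale c T) t)

/-! ### Polar coordinates and the periodic orbits of the unperturbed system. -/

/-- The coordinate `u = x √(1 + x²/2)`, in which `H = (u² + y²)/2`. -/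
def toCirc (x : ℝ) : ℝ := x * √(1 + x ^ 2 / 2)

/-- The inverse of `toCirc`. -/
def ofCirc (u : ℝ) : ℝ := u * √(2 / (1 + √(1 + 2 * u ^ 2)))

/-- The derivative of `toCirc`. -/
def circSpeed (x : ℝ) : ℝ := (1 + x ^ 2) / √(1 + x ^ 2 / 2)

lemma toCirc_sq (x : ℝ) : toCirc x ^ 2 = x ^ 2 + x ^ 4 / 2 := by
  rw [toCirc, mul_pow, Real.sq_sqrt (by positivity)]
  ring

lemma circSpeed_pos (x : ℝ) : 0 < circSpeed x := by
  unfold circSpeed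
  positivity

lemma circSpeed_mul_toCirc (x : ℝ) : circSpeed x * toCirc x = x + x ^ 3 := by
  have : √(1 + x ^ 2 / 2) ≠ 0 := by positivity
  unfold circSpeed toCirc
  field_simp

lemma hasDerivAt_toCirc (x : ℝ) : HasDerivAt toCirc (circSpeed x) x := by
  have hpos : 1 + x ^ 2 / 2 ≠ 0 := by positivity
  have h1 : HasDerivAt (fun x : ℝ => 1 + x ^ 2 / 2) x x := by
    have := ((hasDerivAt_pow 2 x).div_const 2).const_add 1
    simpa using this
  have h2 := (hasDerivAt_id x).mul (h1.sqrt hpos)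
  have hs : √(1 + x ^ 2 / 2) ≠ 0 := by positivity
  refine h2.congr_deriv ?_
  unfold circSpeed
  simp only [id]
  field_simp
  rw [Real.sq_sqrt (by positivity)]
  ring

lemma strictMono_toCirc : StrictMono toCirc :=
  strictMono_of_deriv_pos fun x => by
    rw [(hasDerivAt_toCirc x).deriv]
    exact circSpeed_pos x

/-- This is the nonnegative root `x²` of `x² + x⁴/2 = u²`; the rationalised form of `ofCirc` keeps
the sign of `u` and needs no division by `u`. -/
lemma ofCirc_sq (u : ℝ) : ofCirc u ^ 2 = √(1 + 2 * u ^ 2) - 1 := by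
  have h : √(1 + 2 * u ^ 2) ^ 2 = 1 + 2 * u ^ 2 := Real.sq_sqrt (by positivity)
  have hs : 1 + √(1 + 2 * u ^ 2) ≠ 0 := by positivity
  rw [ofCirc, mul_pow, Real.sq_sqrt (by positivity)]
  rw [mul_div_assoc', div_eq_iff hs]
  linear_combination -h

lemma toCirc_ofCirc (u : ℝ) : toCirc (ofCirc u) = u := by
  have hs : 1 + √(1 + 2 * u ^ 2) ≠ 0 := by positivity
  rw [toCirc, ofCirc_sq, ofCirc, mul_assoc, ← Real.sqrt_mul (by positivity)]
  have : 2 / (1 + √(1 + 2 * u ^ 2)) * (1 + (√(1 + 2 * u ^ 2) - 1) / 2) = 1 := by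
    field_simp
    ring
  rw [this, Real.sqrt_one, mul_one]

lemma ofCirc_toCirc (x : ℝ) : ofCirc (toCirc x) = x :=
  strictMono_toCirc.injective (toCirc_ofCirc _)

lemma continuous_ofCirc : Continuous ofCirc := by
  unfold ofCirc
  have : ∀ u : ℝ, 1 + √(1 + 2 * u ^ 2) ≠ 0 := fun u => by positivity
  fun_prop (disch := exact this _)

lemma continuous_circSpeed : Continuous circSpeed := by
  unfold circSpeed
  have : ∀ x : ℝ, √(1 + x ^ 2 / 2) ≠ 0 := fun u => by positivity
  fun_prop (disch := exact this _)

lemma hasDerivAt_ofCirc (u : ℝ) : HasDerivAt ofCirc (circSpeed (ofCirc u))⁻¹ u :=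
  HasDerivAt.of_local_left_inverse continuous_ofCirc.continuousAt
    (hasDerivAt_toCirc _) (circSpeed_pos _).ne' (Eventually.of_forall toCirc_ofCirc)

lemma H_eq_toCirc (p : ℝ × ℝ) : 2 * H p = toCirc p.1 ^ 2 + p.2 ^ 2 := by
  rw [toCirc_sq, H]
  ring

/-- The parametrisation of the oval `{H = h}` by the angle. -/
def ovalPt (h θ : ℝ) : ℝ × ℝ := (ofCirc (√(2 * h) * Real.sin θ), √(2 * h) * Real.cos θ)

lemma continuous_ovalPt (h : ℝ) : Continuous (ovalPt h) := by
  unfold ovalPt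
  have := continuous_ofCirc
  fun_prop

lemma H_ovalPt {h : ℝ} (hh : 0 < h) (θ : ℝ) : H (ovalPt h θ) = h := by
  have h1 := H_eq_toCirc (ovalPt h θ)
  simp only [ovalPt, toCirc_ofCirc] at h1 ⊢
  have h2 : √(2 * h) ^ 2 = 2 * h := Real.sq_sqrt (by positivity)
  have h3 := Real.sin_sq_add_cos_sq θ
  linear_combination h1 / 2 + h2 / 2 * (Real.sin θ ^ 2 + Real.cos θ ^ 2) + h * h3

lemma exists_ovalPt_eq (q : ℝ × ℝ) : ∃ θ, ovalPt (H q) θ = q := by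
  set z : ℂ := ⟨q.2, toCirc q.1⟩
  have hz : ‖z‖ = √(2 * H q) := by
    rw [Complex.norm_def, Complex.normSq_mk, H_eq_toCirc]
    congr 1
    ring
  refine ⟨z.arg, Prod.ext ?_ ?_⟩
  · simp only [ovalPt, ← hz, Complex.norm_mul_sin_arg]
    exact ofCirc_toCirc _
  · simp only [ovalPt, ← hz, Complex.norm_mul_cos_arg]
    rfl

lemma ovalPt_periodic (h : ℝ) : Function.Periodic (ovalPt h) (2 * Real.pi) := by
  intro θ
  simp [ovalPt]

lemma ovalPt_ne {h : ℝ} (hh : 0 < h) {θ₀ θ : ℝ} (hθ : θ ∈ Ioo θ₀ (θ₀ + 2 * Real.pi)) :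
    ovalPt h θ ≠ ovalPt h θ₀ := by
  intro he
  have hr : √(2 * h) ≠ 0 := by positivity
  have h2 := mul_left_cancel₀ hr (congrArg Prod.snd he)
  have h1 := congrArg (fun p => toCirc p.1) he
  simp only [ovalPt, toCirc_ofCirc] at h1
  have h1 := mul_left_cancel₀ hr h1
  have hc : Real.cos (θ - θ₀) = 1 := by
    rw [Real.cos_sub, h1, h2]
    nlinarith [Real.sin_sq_add_cos_sq θ₀]
  rw [Real.cos_eq_one_iff_of_lt_of_lt (by linarith [hθ.1, Real.pi_pos]) (by linarith [hθ.2])] at hc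
  linarith [hθ.1]

lemma hasDerivAt_ovalPt_fst (h θ : ℝ) : HasDerivAt (fun θ => (ovalPt h θ).1)
    ((ovalPt h θ).2 / circSpeed (ovalPt h θ).1) θ := by
  have := (hasDerivAt_ofCirc (√(2 * h) * Real.sin θ)).comp θ
    ((Real.hasDerivAt_sin θ).const_mul √(2 * h))
  refine this.congr_deriv ?_
  simp only [ovalPt]
  ring

/-- In the plane of `(u, y)` the ovals are circles and `X 0` is a rotation with angular speed
`circSpeed`, which is positive; a change of time therefore turns the angle into the flow. -/
lemma hasDerivAt_ovalPt (h θ : ℝ) : HasDerivAt (ovalPt h)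
    ((circSpeed (ovalPt h θ).1)⁻¹ • X 0 (ovalPt h θ)) θ := by
  have h1 := hasDerivAt_ovalPt_fst h θ
  have h2 : HasDerivAt (fun θ => (ovalPt h θ).2) (√(2 * h) * -Real.sin θ) θ :=
    (Real.hasDerivAt_cos θ).const_mul _
  refine (h1.prodMk h2).congr_deriv (Prod.ext ?_ ?_)
  · simp only [X, Prod.smul_fst, smul_eq_mul]
    ring
  · have hw := circSpeed_pos (ovalPt h θ).1
    have : toCirc (ovalPt h θ).1 = √(2 * h) * Real.sin θ := toCirc_ofCirc _
    have h3 := circSpeed_mul_toCirc (ovalPt h θ).1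
    simp only [X, Prod.smul_snd, smul_eq_mul, ← h3, pert, this]
    field_simp
    simp

/-- The time which the unperturbed flow needs from angle `θ₀` to angle `θ`. -/
def ovalTime (h θ₀ θ : ℝ) : ℝ := ∫ φ in θ₀..θ, (circSpeed (ovalPt h φ).1)⁻¹

lemma continuous_inv_speed (h : ℝ) : Continuous fun φ => (circSpeed (ovalPt h φ).1)⁻¹ :=
  (continuous_circSpeed.comp (continuous_ovalPt h).fst).inv₀ fun _ => (circSpeed_pos _).ne'

lemma hasDerivAt_ovalTime (h θ₀ θ : ℝ) :
    HasDerivAt (ovalTime h θ₀) (circSpeed (ovalPt h θ).1)⁻¹ θ :=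
  intervalIntegral.integral_hasDerivAt_right ((continuous_inv_speed h).intervalIntegrable _ _)
    ((continuous_inv_speed h).stronglyMeasurableAtFilter _ _) (continuous_inv_speed h).continuousAt

lemma strictMono_ovalTime (h θ₀ : ℝ) : StrictMono (ovalTime h θ₀) :=
  strictMono_of_deriv_pos fun θ => by
    rw [(hasDerivAt_ovalTime h θ₀ θ).deriv]
    exact inv_pos.2 (circSpeed_pos _)

/-- A uniform lower bound makes the elapsed time unbounded in both directions, so that the angle can
be inverted as a function of time on the whole line. -/
lemma inv_speed_ge {h : ℝ} (hh : 0 < h) (φ : ℝ) :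
    (1 + 2 * h)⁻¹ ≤ (circSpeed (ovalPt h φ).1)⁻¹ := by
  have hx : (ovalPt h φ).1 ^ 2 ≤ 2 * h := by
    have := H_ovalPt hh φ
    unfold H at this
    nlinarith [sq_nonneg (ovalPt h φ).2, sq_nonneg ((ovalPt h φ).1 ^ 2)]
  refine inv_anti₀ (circSpeed_pos _) ?_
  unfold circSpeed
  refine (div_le_self (by positivity) ?_).trans (by linarith)
  exact Real.one_le_sqrt.2 (by nlinarith [sq_nonneg (ovalPt h φ).1])

lemma surjective_ovalTime {h : ℝ} (hh : 0 < h) (θ₀ : ℝ) : Function.Surjective (ovalTime h θ₀) := by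
  have hpos : 0 < (1 + 2 * h)⁻¹ := by positivity
  have hmono : Monotone fun θ => ovalTime h θ₀ θ - (1 + 2 * h)⁻¹ * θ := by
    refine monotone_of_deriv_nonneg ?_ ?_
    · intro θ
      exact ((hasDerivAt_ovalTime h θ₀ θ).sub
        ((hasDerivAt_id θ).const_mul _)).differentiableAt
    · intro θ
      have := (hasDerivAt_ovalTime h θ₀ θ).sub ((hasDerivAt_id θ).const_mul (1 + 2 * h)⁻¹)
      refine le_of_le_of_eq ?_ this.deriv.symm
      linarith [inv_speed_ge hh θ]
  refine Continuous.surjective ?_ ?_ ?_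
  · exact continuous_iff_continuousAt.2 fun θ => (hasDerivAt_ovalTime h θ₀ θ).continuousAt
  · refine tendsto_atTop_mono' atTop ?_
      (tendsto_atTop_add_const_right _ (ovalTime h θ₀ 0) (tendsto_id.const_mul_atTop hpos))
    filter_upwards [eventually_ge_atTop 0] with θ hθ
    have := hmono hθ
    simp only [mul_zero, sub_zero, id] at this ⊢
    linarith
  · refine tendsto_atBot_mono' atBot ?_
      (tendsto_atBot_add_const_right _ (ovalTime h θ₀ 0) (tendsto_id.const_mul_atBot hpos))
    filter_upwards [eventually_le_atBot 0] with θ hθ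
    have := hmono hθ
    simp only [mul_zero, sub_zero, id] at this ⊢
    linarith

lemma ofCirc_neg (u : ℝ) : ofCirc (-u) = -ofCirc u := by
  simp [ofCirc]

lemma ofCirc_sqrt {h : ℝ} (hh : 0 < h) : ofCirc √(2 * h) = xMax h := by
  have h1 : 0 ≤ ofCirc √(2 * h) := by unfold ofCirc; positivity
  rw [xMax, ← Real.sqrt_sq h1, ofCirc_sq, Real.sq_sqrt (by positivity)]
  congr 1
  ring_nf

lemma yPlus_ovalPt {h : ℝ} (hh : 0 < h) (θ : ℝ) :
    yPlus h (ovalPt h θ).1 = |(ovalPt h θ).2| := by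
  have := H_ovalPt hh θ
  rw [yPlus, ← Real.sqrt_sq_eq_abs]
  congr 1
  unfold H at this
  linarith

/-- The substitution `x = x(θ)` gives `dx = y / circSpeed dθ`, which is `y dt`; it is applied to
each of the two graphs that form the oval. -/
lemma integral_half_oval {g : ℝ → ℝ → ℝ} {h : ℝ} {φ : ℝ → ℝ} {a b : ℝ} (hab : a ≤ b)
    (hg : Continuous fun p : ℝ × ℝ => g p.1 p.2) (hφ : Continuous φ)
    (he : ∀ θ ∈ Icc a b, φ (ovalPt h θ).1 = (ovalPt h θ).2) :
    ∫ x in (ovalPt h a).1..(ovalPt h b).1, g x (φ x) =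
      ∫ θ in a..b, g (ovalPt h θ).1 (ovalPt h θ).2 * (ovalPt h θ).2 *
        (circSpeed (ovalPt h θ).1)⁻¹ := by
  have hc := continuous_ovalPt h
  have hgφ : Continuous fun x => g x (φ x) := hg.comp (continuous_id.prodMk hφ)
  rw [← intervalIntegral.integral_comp_mul_deriv (f := fun θ => (ovalPt h θ).1)
    (f' := fun θ => (ovalPt h θ).2 / circSpeed (ovalPt h θ).1) (g := fun x => g x (φ x))
    (fun θ _ => hasDerivAt_ovalPt_fst h θ) ?_ hgφ]
  · refine intervalIntegral.integral_congr fun θ hθ => ?_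
    rw [uIcc_of_le hab] at hθ
    simp only [Function.comp_apply, he θ hθ]
    ring
  · simp only [div_eq_mul_inv]
    exact (hc.snd.mul (continuous_inv_speed h)).continuousOn

lemma ovalIntegral_eq_angle {g : ℝ → ℝ → ℝ} (hg : Continuous fun p : ℝ × ℝ => g p.1 p.2)
    {h : ℝ} (hh : 0 < h) (θ₀ : ℝ) :
    ovalIntegral g h = ∫ θ in θ₀..(θ₀ + 2 * Real.pi),
      g (ovalPt h θ).1 (ovalPt h θ).2 * (ovalPt h θ).2 * (circSpeed (ovalPt h θ).1)⁻¹ := by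
  have hr : 0 ≤ √(2 * h) := Real.sqrt_nonneg _
  have hy : Continuous (yPlus h) := by unfold yPlus; fun_prop
  have e1 : (ovalPt h (-(Real.pi / 2))).1 = -xMax h := by
    simp [ovalPt, ofCirc_neg, ← ofCirc_sqrt hh]
  have e2 : (ovalPt h (Real.pi / 2)).1 = xMax h := by simp [ovalPt, ← ofCirc_sqrt hh]
  have e3 : (ovalPt h (Real.pi / 2 + Real.pi)).1 = -xMax h := by
    simp [ovalPt, Real.sin_add, ofCirc_neg, ← ofCirc_sqrt hh]
  have hpi := Real.pi_pos
  have c1 : ∀ θ ∈ Icc (-(Real.pi / 2)) (Real.pi / 2),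
      yPlus h (ovalPt h θ).1 = (ovalPt h θ).2 := by
    intro θ hθ
    rw [yPlus_ovalPt hh, abs_of_nonneg]
    exact mul_nonneg hr (Real.cos_nonneg_of_mem_Icc hθ)
  have c2 : ∀ θ ∈ Icc (Real.pi / 2) (Real.pi / 2 + Real.pi),
      -yPlus h (ovalPt h θ).1 = (ovalPt h θ).2 := by
    intro θ hθ
    rw [yPlus_ovalPt hh, abs_of_nonpos, neg_neg]
    exact mul_nonpos_of_nonneg_of_nonpos hr
      (Real.cos_nonpos_of_pi_div_two_le_of_le hθ.1 (by linarith [hθ.2]))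
  have i1 := integral_half_oval (by linarith) hg hy c1
  have i2 := integral_half_oval (by linarith) hg hy.neg c2
  rw [e1, e2] at i1
  rw [e2, e3] at i2
  have hc := continuous_ovalPt h
  have hcont : Continuous fun θ => g (ovalPt h θ).1 (ovalPt h θ).2 * (ovalPt h θ).2 *
      (circSpeed (ovalPt h θ).1)⁻¹ :=
    ((hg.comp hc).mul hc.snd).mul (continuous_inv_speed h)
  have hper : Function.Periodic (fun θ => g (ovalPt h θ).1 (ovalPt h θ).2 * (ovalPt h θ).2 *
      (circSpeed (ovalPt h θ).1)⁻¹) (2 * Real.pi) := by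
    intro θ
    simp only [ovalPt_periodic h θ]
  rw [ovalIntegral, i1]
  erw [i2]
  rw [intervalIntegral.integral_add_adjacent_intervals (hcont.intervalIntegrable _ _)
    (hcont.intervalIntegrable _ _), hper.intervalIntegral_add_eq θ₀ (-(Real.pi / 2))]
  congr 1
  ring

/-- The oval of the unperturbed system through `q` is a periodic orbit. -/
theorem exists_periodic_orbit {q : ℝ × ℝ} (hq : 0 < H q) :
    ∃ (T : ℝ) (c : C(ℝ, ℝ × ℝ)), 0 < T ∧ (∀ t, HasDerivAt c (X 0 (c t)) t) ∧ c 0 = q ∧ c T = q ∧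
      (∀ t ∈ Ioo 0 T, c t ≠ q) ∧ (∀ t, H (c t) = H q) ∧
      ∀ g : ℝ → ℝ → ℝ, Continuous (fun p : ℝ × ℝ => g p.1 p.2) →
        ∫ t in (0 : ℝ)..T, g (c t).1 (c t).2 * (c t).2 = ovalIntegral g (H q) := by
  obtain ⟨θ₀, hθ₀⟩ := exists_ovalPt_eq q
  set h := H q
  -- The inverse of the elapsed time is the angle at time `t`; composing it with `ovalPt` gives the
  -- orbit.
  set e : ℝ ≃o ℝ :=
    (strictMono_ovalTime h θ₀).orderIsoOfSurjective _ (surjective_ovalTime hq θ₀)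
  have he : ∀ θ, e θ = ovalTime h θ₀ θ := fun θ => rfl
  have he0 : e θ₀ = 0 := by rw [he]; exact intervalIntegral.integral_same
  have hs0 : e.symm 0 = θ₀ := by rw [← he0, e.symm_apply_apply]
  have hd : ∀ t, HasDerivAt e.symm (circSpeed (ovalPt h (e.symm t)).1) t := by
    intro t
    have := HasDerivAt.of_local_left_inverse e.symm.continuous.continuousAt
      (hasDerivAt_ovalTime h θ₀ (e.symm t)) (inv_pos.2 (circSpeed_pos _)).ne'
      (Eventually.of_forall fun s => e.apply_symm_apply s)
    rwa [inv_inv] at this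
  have hc := continuous_ovalPt h
  have hpi := Real.pi_pos
  refine ⟨e (θ₀ + 2 * Real.pi), ⟨fun t => ovalPt h (e.symm t), hc.comp e.symm.continuous⟩,
    ?_, ?_, ?_, ?_, ?_, ?_, ?_⟩
  · rw [← he0]
    exact e.strictMono (by linarith)
  · intro t
    have := (hasDerivAt_ovalPt h (e.symm t)).scomp t (hd t)
    rw [smul_smul, mul_inv_cancel₀ (circSpeed_pos _).ne', one_smul] at this
    exact this
  · simp [hs0, hθ₀]
  · simp [ovalPt_periodic h θ₀, hθ₀]
  · intro t ht
    simp only [ContinuousMap.coe_mk]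
    rw [← hθ₀]
    refine ovalPt_ne hq ⟨?_, ?_⟩
    · rw [← hs0]
      exact e.symm.strictMono ht.1
    · rw [← e.symm_apply_apply (θ₀ + 2 * Real.pi)]
      exact e.symm.strictMono ht.2
  · intro t
    exact H_ovalPt hq _
  · intro g hg
    rw [ovalIntegral_eq_angle hg hq θ₀]
    have hcs : Continuous fun t => g (ovalPt h (e.symm t)).1 (ovalPt h (e.symm t)).2 *
        (ovalPt h (e.symm t)).2 :=
      ((hg.comp hc).mul hc.snd).comp e.symm.continuous
    have := intervalIntegral.integral_comp_mul_deriv (a := θ₀) (b := θ₀ + 2 * Real.pi)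
      (fun θ _ => hasDerivAt_ovalTime h θ₀ θ) (continuous_inv_speed h).continuousOn hcs
    simp only [Function.comp_apply, ← he, e.symm_apply_apply, he0] at this
    exact this.symm

/-! ### Transversality and the analytic return map. -/

lemma X_zero (p : ℝ × ℝ) : X 0 p = (p.2, -(p.1 + p.1 ^ 3)) := by
  simp [X, pert]

lemma X_zero_ne_zero {p : ℝ × ℝ} (hp : 0 < H p) : X 0 p ≠ 0 := by
  intro h0
  rw [X_zero, Prod.mk_eq_zero] at h0
  have h1 : p.1 * (1 + p.1 ^ 2) = 0 := by linarith [h0.2]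
  have h2 : p.1 = 0 := (mul_eq_zero.1 h1).resolve_right (by positivity)
  simp [H, h0.1, h2] at hp

namespace IsCrossSection

variable {σ : ℝ → ℝ × ℝ}

lemma hasDerivAt (hσ : IsCrossSection σ) {h : ℝ} (hh : 0 < h) :
    HasDerivAt σ (deriv σ h) h :=
  (hσ.analytic h hh).differentiableAt.hasDerivAt

/-- A cross section is transversal to the ovals. -/
lemma transversal (hσ : IsCrossSection σ) {h : ℝ} (hh : 0 < h) :
    (σ h).2 * (deriv σ h).2 + ((σ h).1 + (σ h).1 ^ 3) * (deriv σ h).1 = 1 := by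
  have h1 : HasDerivAt (fun x => (σ x).1) (deriv σ h).1 h := (hσ.hasDerivAt hh).fst
  have h2 : HasDerivAt (fun x => (σ x).2) (deriv σ h).2 h := (hσ.hasDerivAt hh).snd
  have h3 := (((h2.pow 2).div_const 2).add ((h1.pow 2).div_const 2)).add ((h1.pow 4).div_const 4)
  have h4 : HasDerivAt (fun x : ℝ => x) 1 h := hasDerivAt_id h
  have h5 : (fun x : ℝ => x) =ᶠ[𝓝 h] fun x => H (σ x) := by
    filter_upwards [Ioi_mem_nhds hh] with x hx
    exact (hσ.level x hx).symm
  have h6 := (h4.congr_of_eventuallyEq h5.symm).unique h3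
  rw [h6]
  push_cast
  ring

end IsCrossSection

/-- The derivative of `(T, h') ↦ c T - σ h'` is invertible when `σ'` is transversal to the field. -/
lemma isInvertible_transversal {q s : ℝ × ℝ} (hq : 0 < H q)
    (hs : q.2 * s.2 + (q.1 + q.1 ^ 3) * s.1 = 1) :
    ((ContinuousLinearMap.fst ℝ ℝ ℝ).smulRight (X 0 q) -
      (ContinuousLinearMap.snd ℝ ℝ ℝ).smulRight s).IsInvertible := by
  set L := (ContinuousLinearMap.fst ℝ ℝ ℝ).smulRight (X 0 q) -
      (ContinuousLinearMap.snd ℝ ℝ ℝ).smulRight s with hL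
  have hinj : Function.Injective (L : ℝ × ℝ →ₗ[ℝ] ℝ × ℝ) := by
    rw [← LinearMap.ker_eq_bot, LinearMap.ker_eq_bot']
    rintro ⟨a, b⟩ hab
    have hab' : a • X 0 q - b • s = 0 := hab
    have h1 := congrArg Prod.fst hab'
    have h2 := congrArg Prod.snd hab'
    simp [X_zero] at h1 h2
    have hb : b = 0 := by
      -- Pairing with `dH` kills `X 0 q` and takes the value `1` on `s`.
      linear_combination -(q.1 + q.1 ^ 3) * h1 - q.2 * h2 - b * hs
    rw [hb, zero_smul, sub_zero] at hab'
    exact Prod.ext ((smul_eq_zero.1 hab').resolve_right (X_zero_ne_zero hq)) hb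
  exact ⟨(LinearEquiv.ofInjectiveEndo _ hinj).toContinuousLinearEquiv, by ext <;> rfl⟩

lemma analyticAt_eval_one (γ : PathPair) :
    AnalyticAt ℝ (fun γ : PathPair => (γ.1 1, γ.2 1)) γ :=
  (((ContinuousMap.evalCLM ℝ (1 : unitInterval)).comp
    (ContinuousLinearMap.fst ℝ C(unitInterval, ℝ) C(unitInterval, ℝ))).prod
    ((ContinuousMap.evalCLM ℝ (1 : unitInterval)).comp
      (ContinuousLinearMap.snd ℝ C(unitInterval, ℝ) C(unitInterval, ℝ)))).analyticAt γ

lemma curve_one (γ : PathPair) : curve γ 1 = (γ.1 1, γ.2 1) :=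
  curve_of_mem γ (right_mem_Icc.2 zero_le_one)

/-- The trajectories from the cross section to the cross section close to a periodic orbit of the
unperturbed system, together with their duration and their end. -/
theorem exists_analytic_return {σ : ℝ → ℝ × ℝ} (hσ : IsCrossSection σ) {h₀ T₀ : ℝ} (hh₀ : 0 < h₀)
    {c : C(ℝ, ℝ × ℝ)} (hc : ∀ t, HasDerivAt c (X 0 (c t)) t) (hc0 : c 0 = σ h₀)
    (hcT : c T₀ = σ h₀) :
    ∃ (Γ : ℝ × (Fin 6 → ℝ) → PathPair) (P τ : ℝ × (Fin 6 → ℝ) → ℝ),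
      ContinuousAt Γ (h₀, 0) ∧ AnalyticAt ℝ P (h₀, 0) ∧ ContinuousAt τ (h₀, 0) ∧
      Γ (h₀, 0) = rescale c T₀ ∧ P (h₀, 0) = h₀ ∧ τ (h₀, 0) = T₀ ∧
      ∀ᶠ y in 𝓝 (h₀, (0 : Fin 6 → ℝ)),
        defect ((τ y, σ y.1, y.2), Γ y) = 0 ∧ curve (Γ y) 1 = σ (P y) := by
  have hq : 0 < H (σ h₀) := by rwa [hσ.level h₀ hh₀]
  have hdef : ∀ T, defect ((T, σ h₀, 0), rescale c T) = 0 := by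
    intro T
    rw [← hc0]
    exact defect_rescale hc T
  obtain ⟨Γ, hΓa, hΓ0, hΓd, hΓu⟩ := exists_analytic_flow (hdef T₀)
  set u₀ : (ℝ × (Fin 6 → ℝ)) × (ℝ × ℝ) := ((h₀, 0), (T₀, h₀)) with hu₀
  set F : (ℝ × (Fin 6 → ℝ)) × (ℝ × ℝ) → ℝ × ℝ := fun u =>
    ((Γ (u.2.1, σ u.1.1, u.1.2)).1 1, (Γ (u.2.1, σ u.1.1, u.1.2)).2 1) - σ u.2.2 with hF
  have p11 : AnalyticAt ℝ (fun u : (ℝ × (Fin 6 → ℝ)) × (ℝ × ℝ) => u.1.1) u₀ :=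
    analyticAt_fst.comp analyticAt_fst
  have p12 : AnalyticAt ℝ (fun u : (ℝ × (Fin 6 → ℝ)) × (ℝ × ℝ) => u.1.2) u₀ :=
    analyticAt_snd.comp analyticAt_fst
  have p21 : AnalyticAt ℝ (fun u : (ℝ × (Fin 6 → ℝ)) × (ℝ × ℝ) => u.2.1) u₀ :=
    analyticAt_fst.comp analyticAt_snd
  have p22 : AnalyticAt ℝ (fun u : (ℝ × (Fin 6 → ℝ)) × (ℝ × ℝ) => u.2.2) u₀ :=
    analyticAt_snd.comp analyticAt_snd
  have hpar : AnalyticAt ℝ (fun u : (ℝ × (Fin 6 → ℝ)) × (ℝ × ℝ) =>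
      (u.2.1, σ u.1.1, u.1.2)) u₀ :=
    p21.prod (((hσ.analytic h₀ hh₀).comp_of_eq p11 rfl).prod p12)
  have hFa : AnalyticAt ℝ F u₀ := by
    refine AnalyticAt.sub ?_ ((hσ.analytic h₀ hh₀).comp_of_eq p22 rfl)
    exact (analyticAt_eval_one _).comp (hΓa.comp_of_eq hpar rfl)
  have hFu : F u₀ = 0 := by
    have h1 : Γ (T₀, σ h₀, 0) = rescale c T₀ := hΓ0
    have h2 : ((rescale c T₀).1 1, (rescale c T₀).2 1) = c T₀ := by
      rw [← curve_one, curve_rescale _ _ (right_mem_Icc.2 zero_le_one), mul_one]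
    simp only [hF, hu₀, h1, h2, hcT, sub_self]
  have cd : ContDiffAt ℝ ω F u₀ := hFa.contDiffAt
  have hω : (ω : WithTop ℕ∞) ≠ 0 := by simp
  -- At `l = 0` the uniqueness clause identifies `Γ` with the rescaled periodic orbit for all
  -- durations near `T₀`, so this partial derivative can be read off from `c` and `σ`.
  have hslice : (fun v : ℝ × ℝ => F ((h₀, 0), v)) =ᶠ[𝓝 (T₀, h₀)] fun v => c v.1 - σ v.2 := by
    have hcont : Tendsto (fun v : ℝ × ℝ => (((v.1, σ h₀, (0 : Fin 6 → ℝ))), rescale c v.1))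
        (𝓝 (T₀, h₀)) (𝓝 ((T₀, σ h₀, (0 : Fin 6 → ℝ)), rescale c T₀)) := by
      have := continuous_rescale c
      exact Continuous.tendsto (f := fun v : ℝ × ℝ =>
        (((v.1, σ h₀, (0 : Fin 6 → ℝ))), rescale c v.1)) (by fun_prop) (T₀, h₀)
    filter_upwards [hcont.eventually hΓu] with v hv
    have h1 := hv (hdef v.1)
    have h2 : ((rescale c v.1).1 1, (rescale c v.1).2 1) = c v.1 := by
      rw [← curve_one, curve_rescale _ _ (right_mem_Icc.2 zero_le_one), mul_one]
    simp only [hF, h1, h2]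
  have hd : HasFDerivAt (fun v : ℝ × ℝ => F ((h₀, 0), v))
      ((ContinuousLinearMap.fst ℝ ℝ ℝ).smulRight (X 0 (σ h₀)) -
        (ContinuousLinearMap.snd ℝ ℝ ℝ).smulRight (deriv σ h₀)) (T₀, h₀) := by
    refine HasFDerivAt.congr_of_eventuallyEq ?_ hslice
    have h1 : HasDerivAt c (X 0 (σ h₀)) T₀ := by
      have := hc T₀
      rwa [hcT] at this
    have h2 := h1.hasFDerivAt.comp (T₀, h₀) (hasFDerivAt_fst (𝕜 := ℝ) (E := ℝ) (F := ℝ))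
    have h3 := (hσ.hasDerivAt hh₀).hasFDerivAt.comp (T₀, h₀)
      (hasFDerivAt_snd (𝕜 := ℝ) (E := ℝ) (F := ℝ))
    refine (h2.sub h3).congr_fderiv ?_
    ext <;> simp
  have hcomp : HasFDerivAt (fun v : ℝ × ℝ => F ((h₀, 0), v))
      (fderiv ℝ F u₀ ∘L .inr ℝ (ℝ × (Fin 6 → ℝ)) (ℝ × ℝ)) (T₀, h₀) :=
    (cd.differentiableAt hω).hasFDerivAt.comp (T₀, h₀) (hasFDerivAt_prodMk_right _ _)
  have hinv : (fderiv ℝ F u₀ ∘L .inr ℝ (ℝ × (Fin 6 → ℝ)) (ℝ × ℝ)).IsInvertible := by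
    rw [hcomp.unique hd]
    exact isInvertible_transversal hq (hσ.transversal hh₀)
  set ψ := cd.implicitFunction hω hinv
  have hψ0 : ψ (h₀, 0) = (T₀, h₀) := cd.implicitFunction_apply_self hω hinv
  have hψa : AnalyticAt ℝ ψ (h₀, 0) := (cd.contDiffAt_implicitFunction hω hinv).analyticAt
  have hpar' : ContinuousAt (fun y : ℝ × (Fin 6 → ℝ) => ((ψ y).1, σ y.1, y.2)) (h₀, 0) := by
    have h1 : ContinuousAt (fun y : ℝ × (Fin 6 → ℝ) => σ y.1) (h₀, 0) :=
      ContinuousAt.comp_of_eq (hσ.analytic h₀ hh₀).continuousAt continuousAt_fst rfl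
    exact hψa.continuousAt.fst.prodMk (h1.prodMk continuousAt_snd)
  refine ⟨fun y => Γ ((ψ y).1, σ y.1, y.2), fun y => (ψ y).2, fun y => (ψ y).1,
    ?_, ?_, hψa.continuousAt.fst, ?_, ?_, ?_, ?_⟩
  · exact ContinuousAt.comp_of_eq hΓa.continuousAt hpar' (by simp [hψ0])
  · exact analyticAt_snd.comp hψa
  · simp [hψ0, hΓ0]
  · simp [hψ0]
  · simp [hψ0]
  · have ht : Tendsto (fun y : ℝ × (Fin 6 → ℝ) => ((ψ y).1, σ y.1, y.2)) (𝓝 (h₀, 0))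
        (𝓝 (T₀, σ h₀, 0)) := by
      have := hpar'.tendsto
      rwa [hψ0] at this
    filter_upwards [ht.eventually hΓd, cd.eventually_apply_implicitFunction hω hinv] with y h1 h2
    refine ⟨h1, ?_⟩
    rw [hFu] at h2
    rw [curve_one]
    exact sub_eq_zero.1 h2

/-! ### Absence of earlier crossings, and uniqueness of the first return. -/

lemma continuous_H : Continuous H := by
  unfold H
  fun_prop

lemma hasDerivWithinAt_H {c : ℝ → ℝ × ℝ} {v : ℝ × ℝ} {S : Set ℝ} {s : ℝ}
    (hc : HasDerivWithinAt c v S s) :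
    HasDerivWithinAt (fun s => H (c s)) ((c s).2 * v.2 + ((c s).1 + (c s).1 ^ 3) * v.1) S s := by
  have h1 : HasDerivWithinAt (fun s => (c s).1) v.1 S s := hc.fst
  have h2 : HasDerivWithinAt (fun s => (c s).2) v.2 S s := hc.snd
  have h3 := (((h2.pow 2).div_const 2).add ((h1.pow 2).div_const 2)).add ((h1.pow 4).div_const 4)
  refine h3.congr_deriv ?_
  push_cast
  ring

/-- The displacement from the cross section, measured in the direction `n`. -/
def sectionDist (σ : ℝ → ℝ × ℝ) (n p : ℝ × ℝ) : ℝ :=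
  (p.1 - (σ (H p)).1) * n.1 + (p.2 - (σ (H p)).2) * n.2

/-- The derivative of `sectionDist` along the vector field `X_l`. -/
def sectionSpeed (σ : ℝ → ℝ × ℝ) (n : ℝ × ℝ) (l : Fin 6 → ℝ) (p : ℝ × ℝ) : ℝ :=
  ((X l p).1 - pert l p * p.2 ^ 2 * (deriv σ (H p)).1) * n.1 +
    ((X l p).2 - pert l p * p.2 ^ 2 * (deriv σ (H p)).2) * n.2

namespace IsCrossSection

variable {σ : ℝ → ℝ × ℝ}

lemma mem_image_iff (hσ : IsCrossSection σ) {p : ℝ × ℝ} (hp : 0 < H p) :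
    p ∈ σ '' Ioi 0 ↔ σ (H p) = p := by
  constructor
  · rintro ⟨x, hx, rfl⟩
    rw [hσ.level x hx]
  · intro h
    exact ⟨H p, hp, h⟩

lemma sectionDist_eq_zero (hσ : IsCrossSection σ) (n : ℝ × ℝ) {h : ℝ} (hh : 0 < h) :
    sectionDist σ n (σ h) = 0 := by
  simp [sectionDist, hσ.level h hh]

lemma sectionDist_eq_zero_of_mem (hσ : IsCrossSection σ) (n : ℝ × ℝ) {p : ℝ × ℝ}
    (hp : p ∈ σ '' Ioi 0) : sectionDist σ n p = 0 := by
  obtain ⟨x, hx, rfl⟩ := hp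
  exact hσ.sectionDist_eq_zero n hx

lemma hasDerivWithinAt_sectionDist (hσ : IsCrossSection σ) (n : ℝ × ℝ) {l : Fin 6 → ℝ}
    {c : ℝ → ℝ × ℝ} {S : Set ℝ} {s T : ℝ} (hc : HasDerivWithinAt c (T • X l (c s)) S s)
    (hH : 0 < H (c s)) :
    HasDerivWithinAt (fun s => sectionDist σ n (c s)) (T * sectionSpeed σ n l (c s)) S s := by
  have h1 : HasDerivWithinAt (fun s => (c s).1) (T * (X l (c s)).1) S s := hc.fst
  have h2 : HasDerivWithinAt (fun s => (c s).2) (T * (X l (c s)).2) S s := hc.snd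
  have h3 := (hσ.hasDerivAt hH).scomp_hasDerivWithinAt s (hasDerivWithinAt_H hc)
  have h4 : HasDerivWithinAt (fun s => (σ (H (c s))).1) _ S s := h3.fst
  have h5 : HasDerivWithinAt (fun s => (σ (H (c s))).2) _ S s := h3.snd
  refine (((h1.sub h4).mul_const n.1).add ((h2.sub h5).mul_const n.2)).congr_deriv ?_
  simp only [sectionSpeed, X, Prod.smul_fst, Prod.smul_snd, smul_eq_mul]
  ring

lemma continuousAt_sectionSpeed (hσ : IsCrossSection σ) (n : ℝ × ℝ) (l : Fin 6 → ℝ)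
    {p : ℝ × ℝ} (hp : 0 < H p) :
    ContinuousAt (fun u : (Fin 6 → ℝ) × (ℝ × ℝ) => sectionSpeed σ n u.1 u.2) (l, p) := by
  have h1 : ContinuousAt (fun u : (Fin 6 → ℝ) × (ℝ × ℝ) => deriv σ (H u.2)) (l, p) :=
    ContinuousAt.comp_of_eq (hσ.analytic (H p) hp).deriv.continuousAt
      (continuous_H.comp continuous_snd).continuousAt rfl
  have h2 : ContinuousAt (fun u : (Fin 6 → ℝ) × (ℝ × ℝ) => X u.1 u.2) (l, p) :=
    continuous_X.continuousAt
  have h3 : ContinuousAt (fun u : (Fin 6 → ℝ) × (ℝ × ℝ) => pert u.1 u.2) (l, p) := by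
    unfold pert
    fun_prop
  unfold sectionSpeed
  fun_prop

/-- Without perturbation `H` is constant along the flow, so with the normal `X 0 (σ h)` the speed is
the squared length of the field. -/
lemma sectionSpeed_pos (hσ : IsCrossSection σ) {h : ℝ} (hh : 0 < h) :
    0 < sectionSpeed σ (X 0 (σ h)) 0 (σ h) := by
  have hq : 0 < H (σ h) := by rwa [hσ.level h hh]
  have h1 : sectionSpeed σ (X 0 (σ h)) 0 (σ h) =
      (X 0 (σ h)).1 * (X 0 (σ h)).1 + (X 0 (σ h)).2 * (X 0 (σ h)).2 := by
    simp [sectionSpeed, pert]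
  have h2 := X_zero_ne_zero hq
  rw [h1]
  rcases eq_or_ne (X 0 (σ h)).1 0 with h3 | h3
  · have h4 : (X 0 (σ h)).2 ≠ 0 := fun h4 => h2 (Prod.ext h3 h4)
    exact add_pos_of_nonneg_of_pos (mul_self_nonneg _) (mul_self_pos.2 h4)
  · exact add_pos_of_pos_of_nonneg (mul_self_pos.2 h3) (mul_self_nonneg _)

end IsCrossSection

lemma continuousAt_curve {Γ : ℝ × (Fin 6 → ℝ) → PathPair}
    {y₀ : ℝ × (Fin 6 → ℝ)} (hΓ : ContinuousAt Γ y₀) (s₀ : ℝ) :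
    ContinuousAt (fun z : (ℝ × (Fin 6 → ℝ)) × ℝ => curve (Γ z.1) z.2) (y₀, s₀) := by
  have h1 : ContinuousAt (fun z : (ℝ × (Fin 6 → ℝ)) × ℝ => (Γ z.1, z.2)) (y₀, s₀) :=
    (ContinuousAt.comp_of_eq hΓ continuousAt_fst rfl).prodMk continuousAt_snd
  exact ContinuousAt.comp_of_eq continuous_curve_uncurry.continuousAt h1 rfl

/-- Near the cross section, trajectories cross it in one direction. -/
lemma eventually_sectionDist_lt {σ : ℝ → ℝ × ℝ} (hσ : IsCrossSection σ) {h₀ : ℝ} (hh₀ : 0 < h₀)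
    {Γ : ℝ × (Fin 6 → ℝ) → PathPair}
    {τ : ℝ × (Fin 6 → ℝ) → ℝ} (hΓ : ContinuousAt Γ (h₀, 0))
    (hdef : ∀ᶠ y in 𝓝 (h₀, (0 : Fin 6 → ℝ)), defect ((τ y, σ y.1, y.2), Γ y) = 0)
    (hτ : ∀ᶠ y in 𝓝 (h₀, (0 : Fin 6 → ℝ)), 0 < τ y) {s₀ : ℝ}
    (hs₀ : curve (Γ (h₀, 0)) s₀ = σ h₀) :
    ∃ δ > 0, ∀ᶠ y in 𝓝 (h₀, (0 : Fin 6 → ℝ)), ∀ a ∈ Icc (0 : ℝ) 1, ∀ b ∈ Icc (0 : ℝ) 1,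
      dist a s₀ < δ → dist b s₀ < δ → a < b →
        sectionDist σ (X 0 (σ h₀)) (curve (Γ y) a) <
          sectionDist σ (X 0 (σ h₀)) (curve (Γ y) b) := by
  have hq : 0 < H (σ h₀) := by rwa [hσ.level h₀ hh₀]
  have hcurve := continuousAt_curve hΓ s₀
  have hspeed : ContinuousAt (fun z : (ℝ × (Fin 6 → ℝ)) × ℝ =>
      sectionSpeed σ (X 0 (σ h₀)) z.1.2 (curve (Γ z.1) z.2)) ((h₀, 0), s₀) := by
    refine ContinuousAt.comp_of_eq (hσ.continuousAt_sectionSpeed (X 0 (σ h₀)) 0 hq)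
      (ContinuousAt.prodMk (by fun_prop) hcurve) ?_
    simp [hs₀]
  have e1 : ∀ᶠ z : (ℝ × (Fin 6 → ℝ)) × ℝ in 𝓝 ((h₀, 0), s₀),
      0 < sectionSpeed σ (X 0 (σ h₀)) z.1.2 (curve (Γ z.1) z.2) := by
    refine hspeed.tendsto.eventually_const_lt ?_
    simp only [hs₀]
    exact hσ.sectionSpeed_pos hh₀
  have e2 : ∀ᶠ z : (ℝ × (Fin 6 → ℝ)) × ℝ in 𝓝 ((h₀, 0), s₀), 0 < H (curve (Γ z.1) z.2) := by
    refine (continuous_H.continuousAt.comp hcurve).tendsto.eventually_const_lt ?_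
    simpa [hs₀] using hq
  have e3 := e1.and e2
  rw [nhds_prod_eq, Metric.eventually_prod_nhds_iff] at e3
  obtain ⟨pa, hpa, δ, hδ, hpos⟩ := e3
  refine ⟨δ, hδ, ?_⟩
  filter_upwards [hpa, hdef, hτ] with y hy hdy hτy a ha b hb had hbd hab
  have hsub : ∀ s ∈ Icc a b, dist s s₀ < δ ∧ s ∈ Icc (0 : ℝ) 1 := by
    intro s hs
    refine ⟨?_, ha.1.trans hs.1, hs.2.trans hb.2⟩
    rw [Real.dist_eq, abs_lt] at had hbd ⊢
    exact ⟨by linarith [hs.1], by linarith [hs.2]⟩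
  have hd : ∀ s ∈ Icc a b, HasDerivWithinAt
      (fun s => sectionDist σ (X 0 (σ h₀)) (curve (Γ y) s))
      (τ y * sectionSpeed σ (X 0 (σ h₀)) y.2 (curve (Γ y) s)) (Icc 0 1) s := by
    intro s hs
    exact hσ.hasDerivWithinAt_sectionDist _ (hasDerivWithinAt_curve hdy (hsub s hs).2)
      (hpos hy (hsub s hs).1).2
  refine strictMonoOn_of_deriv_pos
    (f := fun s => sectionDist σ (X 0 (σ h₀)) (curve (Γ y) s)) (convex_Icc a b)
    (fun s hs => ?_) (fun s hs => ?_) (left_mem_Icc.2 hab.le) (right_mem_Icc.2 hab.le) hab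
  · exact (hd s hs).continuousWithinAt.mono (Icc_subset_Icc ha.1 hb.2)
  · rw [interior_Icc] at hs
    have := (hd s (Ioo_subset_Icc_self hs)).hasDerivAt
      (Icc_mem_nhds (ha.1.trans_lt hs.1) (hs.2.trans_le hb.2))
    rw [this.deriv]
    exact mul_pos hτy (hpos hy (hsub s (Ioo_subset_Icc_self hs)).1).1

/-- Trajectories close to a periodic orbit do not meet the cross section before they complete
the turn. -/
lemma eventually_no_early_return {σ : ℝ → ℝ × ℝ} (hσ : IsCrossSection σ) {h₀ : ℝ} (hh₀ : 0 < h₀)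
    {Γ : ℝ × (Fin 6 → ℝ) → PathPair}
    {P τ : ℝ × (Fin 6 → ℝ) → ℝ} (hΓ : ContinuousAt Γ (h₀, 0))
    (hdef : ∀ᶠ y in 𝓝 (h₀, (0 : Fin 6 → ℝ)), defect ((τ y, σ y.1, y.2), Γ y) = 0)
    (hτ : ∀ᶠ y in 𝓝 (h₀, (0 : Fin 6 → ℝ)), 0 < τ y)
    (hP : ∀ᶠ y in 𝓝 (h₀, (0 : Fin 6 → ℝ)), 0 < P y)
    (hend : ∀ᶠ y in 𝓝 (h₀, (0 : Fin 6 → ℝ)), curve (Γ y) 1 = σ (P y))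
    (h0 : curve (Γ (h₀, 0)) 0 = σ h₀) (h1 : curve (Γ (h₀, 0)) 1 = σ h₀)
    (hne : ∀ s ∈ Ioo (0 : ℝ) 1, curve (Γ (h₀, 0)) s ≠ σ h₀)
    (hH : ∀ s ∈ Icc (0 : ℝ) 1, H (curve (Γ (h₀, 0)) s) = h₀) :
    ∀ᶠ y in 𝓝 (h₀, (0 : Fin 6 → ℝ)), ∀ s ∈ Ioo (0 : ℝ) 1, curve (Γ y) s ∉ σ '' Ioi 0 := by
  have hyp : ∀ᶠ y : ℝ × (Fin 6 → ℝ) in 𝓝 (h₀, 0), 0 < y.1 :=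
    continuousAt_fst.eventually_const_lt hh₀
  have key : ∀ s₀ ∈ Icc (0 : ℝ) 1, ∀ᶠ z : (ℝ × (Fin 6 → ℝ)) × ℝ in 𝓝 ((h₀, 0), s₀),
      z.2 ∈ Ioo (0 : ℝ) 1 → curve (Γ z.1) z.2 ∉ σ '' Ioi 0 := by
    intro s₀ hs₀
    rcases eq_or_ne s₀ 0 with rfl | hs0
    -- Near the start, `sectionDist` vanishes at `s = 0` and increases strictly, so it cannot vanish
    -- again; the end of the turn is treated in the same way with `s = 1`.
    · obtain ⟨δ, hδ, hev⟩ := eventually_sectionDist_lt hσ hh₀ hΓ hdef hτ h0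
      rw [nhds_prod_eq]
      filter_upwards [(hev.and (hdef.and hyp)).prod_mk (Metric.ball_mem_nhds (0 : ℝ) hδ)]
        with z ⟨⟨hz, hdz, hz1⟩, hzδ⟩ hz01 hmem
      have := hz 0 (by simp) z.2 (Ioo_subset_Icc_self hz01) (by simpa using hδ) hzδ hz01.1
      rw [curve_zero_of_defect hdz, hσ.sectionDist_eq_zero _ hz1,
        hσ.sectionDist_eq_zero_of_mem _ hmem] at this
      exact lt_irrefl _ this
    rcases eq_or_ne s₀ 1 with rfl | hs1
    · obtain ⟨δ, hδ, hev⟩ := eventually_sectionDist_lt hσ hh₀ hΓ hdef hτ h1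
      rw [nhds_prod_eq]
      filter_upwards [(hev.and (hend.and hP)).prod_mk (Metric.ball_mem_nhds (1 : ℝ) hδ)]
        with z ⟨⟨hz, hez, hz1⟩, hzδ⟩ hz01 hmem
      have := hz z.2 (Ioo_subset_Icc_self hz01) 1 (by simp) hzδ (by simpa using hδ) hz01.2
      rw [hez, hσ.sectionDist_eq_zero _ hz1, hσ.sectionDist_eq_zero_of_mem _ hmem] at this
      exact lt_irrefl _ this
    have hs : s₀ ∈ Ioo (0 : ℝ) 1 :=
      ⟨lt_of_le_of_ne hs₀.1 (Ne.symm hs0), lt_of_le_of_ne hs₀.2 hs1⟩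
    have hcurve := continuousAt_curve hΓ s₀
    have hHc : ContinuousAt (fun z : (ℝ × (Fin 6 → ℝ)) × ℝ => H (curve (Γ z.1) z.2))
        ((h₀, 0), s₀) :=
      continuous_H.continuousAt.comp hcurve
    have hσc : ContinuousAt (fun z : (ℝ × (Fin 6 → ℝ)) × ℝ => σ (H (curve (Γ z.1) z.2)))
        ((h₀, 0), s₀) :=
      ContinuousAt.comp_of_eq (hσ.analytic h₀ hh₀).continuousAt hHc (hH s₀ hs₀)
    -- In the interior, being off the section means `σ (H p) ≠ p`, which is an open condition.
    have e1 : ∀ᶠ z : (ℝ × (Fin 6 → ℝ)) × ℝ in 𝓝 ((h₀, 0), s₀),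
        σ (H (curve (Γ z.1) z.2)) ≠ curve (Γ z.1) z.2 := by
      refine (hσc.ne_iff_eventually_ne hcurve).1 ?_
      simp only [hH s₀ hs₀]
      exact (hne s₀ hs).symm
    have e2 : ∀ᶠ z : (ℝ × (Fin 6 → ℝ)) × ℝ in 𝓝 ((h₀, 0), s₀), 0 < H (curve (Γ z.1) z.2) := by
      refine hHc.tendsto.eventually_const_lt ?_
      simpa [hH s₀ hs₀] using hh₀
    filter_upwards [e1, e2] with z hz1 hz2 _ hmem
    exact hz1 ((hσ.mem_image_iff hz2).1 hmem)
  filter_upwards [isCompact_Icc.eventually_forall_of_forall_eventually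
    (P := fun y s => s ∈ Ioo (0 : ℝ) 1 → curve (Γ y) s ∉ σ '' Ioi 0) key] with y hy s hs
  exact hy s (Ioo_subset_Icc_self hs) hs

/-- Trajectories are determined by their initial point. -/
lemma integralCurve_eqOn {l : Fin 6 → ℝ} {T : ℝ} {γ₁ γ₂ : ℝ → ℝ × ℝ}
    (h₁ : IsIntegralCurveOn γ₁ (fun _ => X l) (Icc 0 T))
    (h₂ : IsIntegralCurveOn γ₂ (fun _ => X l) (Icc 0 T)) (h0 : γ₁ 0 = γ₂ 0) :
    EqOn γ₁ γ₂ (Icc 0 T) := by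
  have c₁ : ContinuousOn γ₁ (Icc 0 T) := fun t ht => (h₁ t ht).continuousWithinAt
  have c₂ : ContinuousOn γ₂ (Icc 0 T) := fun t ht => (h₂ t ht).continuousWithinAt
  -- The field is only locally Lipschitz; a Lipschitz constant exists on the compact set swept by
  -- both curves.
  have hcomp : IsCompact (γ₁ '' Icc 0 T ∪ γ₂ '' Icc 0 T) :=
    (isCompact_Icc.image_of_continuousOn c₁).union (isCompact_Icc.image_of_continuousOn c₂)
  have hX : ContDiff ℝ 1 (X l) := by
    unfold X pert
    fun_prop
  obtain ⟨K, hK⟩ :=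
    hX.locallyLipschitz.locallyLipschitzOn.exists_lipschitzOnWith_of_compact hcomp
  have hder : ∀ γ : ℝ → ℝ × ℝ, IsIntegralCurveOn γ (fun _ => X l) (Icc 0 T) →
      ∀ t ∈ Ico 0 T, HasDerivWithinAt γ (X l (γ t)) (Ici t) t := by
    intro γ hγ t ht
    exact (hγ t (Ico_subset_Icc_self ht)).mono_of_mem_nhdsWithin
      (mem_of_superset (Icc_mem_nhdsGE ht.2) (Icc_subset_Icc_left ht.1))
  exact ODE_solution_unique_of_mem_Icc_right (v := fun _ => X l)
    (s := fun _ => γ₁ '' Icc 0 T ∪ γ₂ '' Icc 0 T) (fun t _ => hK) c₁ (hder γ₁ h₁)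
    (fun t ht => Or.inl (mem_image_of_mem _ (Ico_subset_Icc_self ht))) c₂ (hder γ₂ h₂)
    (fun t ht => Or.inr (mem_image_of_mem _ (Ico_subset_Icc_self ht))) h0

/-- Both trajectories agree up to the shorter duration; if the durations differed, the longer
trajectory would meet the section too early. -/
lemma IsFirstReturn.unique {σ : ℝ → ℝ × ℝ} (hσ : IsCrossSection σ) {l : Fin 6 → ℝ} {h h₁ h₂ : ℝ}
    (r₁ : IsFirstReturn l σ h h₁) (r₂ : IsFirstReturn l σ h h₂) : h₁ = h₂ := by
  obtain ⟨hp₁, T₁, γ₁, hT₁, hγ₁, hs₁, he₁, hn₁⟩ := r₁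
  obtain ⟨hp₂, T₂, γ₂, hT₂, hγ₂, hs₂, he₂, hn₂⟩ := r₂
  wlog hle : T₁ ≤ T₂ generalizing h₁ h₂ T₁ T₂ γ₁ γ₂
  · exact (this hp₂ T₂ γ₂ hT₂ hγ₂ hs₂ he₂ hn₂ hp₁ T₁ γ₁ hT₁ hγ₁ hs₁ he₁ hn₁
      (le_of_not_ge hle)).symm
  have heq : γ₁ T₁ = γ₂ T₁ :=
    integralCurve_eqOn hγ₁ (hγ₂.mono (Icc_subset_Icc_right hle)) (hs₁.trans hs₂.symm)
      (right_mem_Icc.2 hT₁.le)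
  have hT : T₁ = T₂ := by
    by_contra hne
    refine hn₂ T₁ ⟨hT₁, lt_of_le_of_ne hle hne⟩ ?_
    rw [← heq, he₁]
    exact mem_image_of_mem _ hp₁
  have hσe : σ h₁ = σ h₂ := by rw [← he₁, heq, hT, he₂]
  rw [← hσ.level h₁ hp₁, hσe, hσ.level h₂ hp₂]

lemma isFirstReturn_of_defect {σ : ℝ → ℝ × ℝ} {l : Fin 6 → ℝ} {h h' T : ℝ}
    {γ : PathPair} (hh' : 0 < h') (hT : 0 < T)
    (hdef : defect ((T, σ h, l), γ) = 0) (hend : curve γ 1 = σ h')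
    (hne : ∀ s ∈ Ioo (0 : ℝ) 1, curve γ s ∉ σ '' Ioi 0) : IsFirstReturn l σ h h' := by
  refine ⟨hh', T, fun t => curve γ (t / T), hT, ?_, ?_, ?_, ?_⟩
  · intro t ht
    have hs : t / T ∈ Icc (0 : ℝ) 1 := ⟨div_nonneg ht.1 hT.le, (div_le_one hT).2 ht.2⟩
    have hmaps : MapsTo (fun t => t / T) (Icc 0 T) (Icc 0 1) := fun t ht =>
      ⟨div_nonneg ht.1 hT.le, (div_le_one hT).2 ht.2⟩
    have := (hasDerivWithinAt_curve hdef hs).scomp t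
      ((hasDerivWithinAt_id t (Icc 0 T)).div_const T) hmaps
    rwa [smul_smul, one_div_mul_cancel hT.ne', one_smul] at this
  · simp only [zero_div]
    exact curve_zero_of_defect hdef
  · simp only [div_self hT.ne']
    exact hend
  · intro t ht
    exact hne _ ⟨div_pos ht.1 hT, (div_lt_one hT).2 ht.2⟩

lemma displacement_eq {lam : Fin 6 → ℝ → ℝ} {σ : ℝ → ℝ × ℝ} (hσ : IsCrossSection σ) {h ε h' : ℝ}
    (hr : IsFirstReturn (fun j => lam j ε) σ h h') : displacement lam σ h ε = h' - h := by
  have hex : ∃ h', IsFirstReturn (fun j => lam j ε) σ h h' := ⟨h', hr⟩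
  rw [displacement, dif_pos hex, hex.choose_spec.unique hσ hr]

/-! ### The corrected energy. -/

/-- The direction in parameter space along which the first Melnikov integral vanishes. -/
def nullDir : Fin 6 → ℝ := ![0, -3, 1, -3, 0, 0]

/-- The second order density of the perturbation in the direction `nullDir`. -/
def secondDensity (p : ℝ × ℝ) : ℝ := 6 * p.1 ^ 2 * p.2 ^ 2 - 3 / 2 * p.1 ^ 4 - p.1 ^ 6

/-- The function `g` with `pert nullDir · y dx = dg - 3xy dH`. -/
def firstPrimitive (p : ℝ × ℝ) : ℝ := p.1 * p.2 ^ 3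

/-- The function `G` with `-3xy dg = dG + R dH`, where `R + 9x²y²` is `secondDensity`. -/
def secondPrimitive (p : ℝ × ℝ) : ℝ :=
  -3 * (p.1 ^ 2 * p.2 ^ 4 / 2 - 2 * H p * (p.1 ^ 4 / 4 + p.1 ^ 6 / 6) +
    (p.1 ^ 6 / 6 + 3 / 16 * p.1 ^ 8 + p.1 ^ 10 / 20))

/-- For `δ = 0`, subtracting `μ g` leaves `-3μxy dH = μ² (-3xy η)`, and subtracting `μ² G` leaves
`μ² S dH = μ³ S η`. The part `δ` enters through `dH` only, which gives the factor `1 - 3μxy + μ² S`.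
The identity is exact, with no remainder. -/
lemma hasDerivWithinAt_correctedEnergy {c : ℝ → ℝ × ℝ} {S : Set ℝ} {s T μ : ℝ} {l δ : Fin 6 → ℝ}
    (hc : HasDerivWithinAt c (T • X l (c s)) S s) (hl : ∀ j, l j = nullDir j * μ + δ j) :
    HasDerivWithinAt
      (fun s => H (c s) - μ * firstPrimitive (c s) - μ ^ 2 * secondPrimitive (c s))
      (T * (μ ^ 3 * (secondDensity (c s) * pert nullDir (c s) * (c s).2 ^ 2) +
        (1 - 3 * μ * (c s).1 * (c s).2 + μ ^ 2 * secondDensity (c s)) *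
          (pert δ (c s) * (c s).2 ^ 2))) S s := by
  have h1 : HasDerivWithinAt (fun s => (c s).1) (T * (X l (c s)).1) S s := hc.fst
  have h2 : HasDerivWithinAt (fun s => (c s).2) (T * (X l (c s)).2) S s := hc.snd
  have h3 := hasDerivWithinAt_H hc
  have h4 := (h1.mul (h2.pow 3)).const_mul μ
  have h5 := (((((h1.pow 2).mul (h2.pow 4)).div_const 2).sub
    ((h3.const_mul 2).mul (((h1.pow 4).div_const 4).add ((h1.pow 6).div_const 6)))).add
    ((((h1.pow 6).div_const 6).add ((h1.pow 8).const_mul (3 / 16))).add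
      ((h1.pow 10).div_const 20))).const_mul (-3)
  refine ((h3.sub h4).sub (h5.const_mul (μ ^ 2))).congr_deriv ?_
  simp only [X, pert, hl, secondDensity, Prod.smul_fst, Prod.smul_snd, smul_eq_mul, H, Pi.pow_apply]
  simp [nullDir]
  ring

lemma continuous_secondDensity : Continuous secondDensity := by
  unfold secondDensity
  fun_prop

lemma continuous_pert (l : Fin 6 → ℝ) : Continuous (pert l) := by
  unfold pert
  fun_prop

/-! ### Reduction of the Melnikov integrals modulo exact forms. -/

section Loop

variable {c : C(ℝ, ℝ × ℝ)} {T : ℝ}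

lemma hasDerivAt_monomial (hc : ∀ t, HasDerivAt c (X 0 (c t)) t) (a b : ℕ) (t : ℝ) :
    HasDerivAt (fun t => (c t).1 ^ a * (c t).2 ^ b)
      (a * (c t).1 ^ (a - 1) * (c t).2 * (c t).2 ^ b -
        (c t).1 ^ a * (b * (c t).2 ^ (b - 1) * ((c t).1 + (c t).1 ^ 3))) t := by
  have h1 : HasDerivAt (fun s => (c s).1) (X 0 (c t)).1 t := (hc t).fst
  have h2 : HasDerivAt (fun s => (c s).2) (X 0 (c t)).2 t := (hc t).snd
  refine ((h1.pow a).mul (h2.pow b)).congr_deriv ?_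
  simp only [X_zero, Pi.pow_apply]
  ring

lemma integral_eq_of_exact {f g F : ℝ → ℝ} (hf : Continuous f) (hg : Continuous g)
    (hF : ∀ t, HasDerivAt F (f t - g t) t) (hT : F T = F 0) :
    ∫ t in (0 : ℝ)..T, f t = ∫ t in (0 : ℝ)..T, g t := by
  have h1 := intervalIntegral.integral_eq_sub_of_hasDerivAt (fun t _ => hF t)
    ((hf.sub hg).intervalIntegrable 0 T)
  rw [intervalIntegral.integral_sub (hf.intervalIntegrable _ _) (hg.intervalIntegrable _ _), hT,
    sub_self] at h1
  linarith

/-- Integral along a closed orbit of the forms `y dx` and `x² y dx` with constant coefficients. -/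
lemma integral_basic {h : ℝ}
    (hg : ∀ g : ℝ → ℝ → ℝ, Continuous (fun p : ℝ × ℝ => g p.1 p.2) →
        ∫ t in (0 : ℝ)..T, g (c t).1 (c t).2 * (c t).2 = ovalIntegral g h) (a b : ℝ) :
    ∫ t in (0 : ℝ)..T, (a * ((c t).1 ^ 2 * (c t).2 ^ 2) + b * (c t).2 ^ 2) =
      a * I₂ h + b * I₀ h := by
  rw [intervalIntegral.integral_add
    ((by fun_prop : Continuous _).intervalIntegrable _ _)
    ((by fun_prop : Continuous _).intervalIntegrable _ _),
    intervalIntegral.integral_const_mul, intervalIntegral.integral_const_mul, I₂, I₀,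
    ← hg _ (by fun_prop), ← hg _ (by fun_prop)]
  congr 2
  · refine intervalIntegral.integral_congr fun t _ => ?_
    ring
  · refine intervalIntegral.integral_congr fun t _ => ?_
    ring

/-- The first Melnikov integral. -/
lemma integral_pert (hc : ∀ t, HasDerivAt c (X 0 (c t)) t) (hT : c T = c 0) {h : ℝ}
    (hH : ∀ t, H (c t) = h)
    (hg : ∀ g : ℝ → ℝ → ℝ, Continuous (fun p : ℝ × ℝ => g p.1 p.2) →
        ∫ t in (0 : ℝ)..T, g (c t).1 (c t).2 * (c t).2 = ovalIntegral g h) (l : Fin 6 → ℝ) :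
    ∫ t in (0 : ℝ)..T, pert l (c t) * (c t).2 ^ 2 = linearPart l h := by
  rw [linearPart, ← integral_basic hg]
  have hp := continuous_pert l
  refine integral_eq_of_exact
    -- The coefficients solve the linear system that results from matching the derivative of a
    -- combination of monomials `xᵃyᵇ` with the difference of the integrands, where `h` is replaced
    -- by `H`.
    (F := fun t => (l 2 / 7 - 2 / 7 * l 3 - 10 / 231 * l 4 + 8 / 21 * l 5) *
        ((c t).1 ^ 1 * (c t).2 ^ 3) + 17 / 77 * l 4 * ((c t).1 ^ 1 * (c t).2 ^ 5) +
        (5 / 63 * l 4 - 2 / 9 * l 5) * ((c t).1 ^ 3 * (c t).2 ^ 3) +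
        5 / 77 * l 4 * ((c t).1 ^ 5 * (c t).2 ^ 3)) (by fun_prop) (by fun_prop) (fun t => ?_)
    (by simp only [hT])
  have hm := fun a b => hasDerivAt_monomial hc a b t
  refine (((((hm 1 3).const_mul _).add ((hm 1 5).const_mul _)).add
    ((hm 3 3).const_mul _)).add ((hm 5 3).const_mul _)).congr_deriv ?_
  rw [← hH t]
  simp only [pert, H]
  push_cast
  ring

/-- The third Melnikov integral in the direction `nullDir`. -/
lemma integral_secondDensity (hc : ∀ t, HasDerivAt c (X 0 (c t)) t) (hT : c T = c 0) {h : ℝ}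
    (hH : ∀ t, H (c t) = h)
    (hg : ∀ g : ℝ → ℝ → ℝ, Continuous (fun p : ℝ × ℝ => g p.1 p.2) →
        ∫ t in (0 : ℝ)..T, g (c t).1 (c t).2 * (c t).2 = ovalIntegral g h) :
    ∫ t in (0 : ℝ)..T, secondDensity (c t) * pert nullDir (c t) * (c t).2 ^ 2 =
      cubicPart 1 h := by
  have e : cubicPart 1 h = -(8 / 1001 * (308 * h ^ 2 + 181 * h + 24)) * I₂ h +
      8 / 1001 * (80 * h ^ 2 + 12 * h) * I₀ h := by
    rw [cubicPart]
    ring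
  rw [e, ← integral_basic hg]
  have hp := continuous_pert nullDir
  have hs := continuous_secondDensity
  refine integral_eq_of_exact
    -- Again found by undetermined coefficients.
    (F := fun t => -48 / 1001 * ((c t).1 ^ 1 * (c t).2 ^ 3) +
        -160 / 1001 * ((c t).1 ^ 1 * (c t).2 ^ 5) + -12 / 91 * ((c t).1 ^ 3 * (c t).2 ^ 3) +
        86 / 39 * ((c t).1 ^ 3 * (c t).2 ^ 5) + -9853 / 6006 * ((c t).1 ^ 5 * (c t).2 ^ 3) +
        -41 / 39 * ((c t).1 ^ 7 * (c t).2 ^ 3)) (by fun_prop) (by fun_prop) (fun t => ?_)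
    (by simp only [hT])
  have hm := fun a b => hasDerivAt_monomial hc a b t
  refine (((((((hm 1 3).const_mul _).add ((hm 1 5).const_mul _)).add
    ((hm 3 3).const_mul _)).add ((hm 3 5).const_mul _)).add ((hm 5 3).const_mul _)).add
    ((hm 7 3).const_mul _)).congr_deriv ?_
  rw [← hH t]
  simp only [pert, H, secondDensity]
  simp [nullDir]
  ring

/-- Used to bound `I₂` from below in terms of `I₀`. -/
lemma integral_quartic (hc : ∀ t, HasDerivAt c (X 0 (c t)) t) (hT : c T = c 0) {h : ℝ}
    (hH : ∀ t, H (c t) = h)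
    (hg : ∀ g : ℝ → ℝ → ℝ, Continuous (fun p : ℝ × ℝ => g p.1 p.2) →
        ∫ t in (0 : ℝ)..T, g (c t).1 (c t).2 * (c t).2 = ovalIntegral g h) :
    ∫ t in (0 : ℝ)..T, 7 / 2 * (c t).1 ^ 4 * (c t).2 ^ 2 = -4 * I₂ h + 2 * h * I₀ h := by
  rw [← integral_basic hg]
  refine integral_eq_of_exact (F := fun t => -1 * ((c t).1 ^ 1 * (c t).2 ^ 3))
    (by fun_prop) (by fun_prop) (fun t => ?_) (by simp only [hT])
  refine ((hasDerivAt_monomial hc 1 3 t).const_mul _).congr_deriv ?_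
  rw [← hH t]
  simp only [H]
  push_cast
  ring

end Loop

/-! ### The first return near an oval. -/

/-- The data of the first return map close to an oval: the periodic orbit `c` of the unperturbed
system with period `T₀`, the perturbed trajectories `Γ`, the return map `P` and the return
time `τ`. -/
structure ReturnData (σ : ℝ → ℝ × ℝ) (h₀ : ℝ) where
  T₀ : ℝ
  c : C(ℝ, ℝ × ℝ)
  Γ : ℝ × (Fin 6 → ℝ) → PathPair
  P : ℝ × (Fin 6 → ℝ) → ℝ
  τ : ℝ × (Fin 6 → ℝ) → ℝ
  T₀_pos : 0 < T₀
  orbit : ∀ t, HasDerivAt c (X 0 (c t)) t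
  c_period : c T₀ = c 0
  c_level : ∀ t, H (c t) = h₀
  c_integral : ∀ g : ℝ → ℝ → ℝ, Continuous (fun p : ℝ × ℝ => g p.1 p.2) →
    ∫ t in (0 : ℝ)..T₀, g (c t).1 (c t).2 * (c t).2 = ovalIntegral g h₀
  Γ_cont : ContinuousAt Γ (h₀, 0)
  P_an : AnalyticAt ℝ P (h₀, 0)
  τ_cont : ContinuousAt τ (h₀, 0)
  Γ_base : Γ (h₀, 0) = rescale c T₀
  P_base : P (h₀, 0) = h₀
  τ_base : τ (h₀, 0) = T₀
  defect_eq : ∀ᶠ y in 𝓝 (h₀, (0 : Fin 6 → ℝ)), defect ((τ y, σ y.1, y.2), Γ y) = 0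
  end_eq : ∀ᶠ y in 𝓝 (h₀, (0 : Fin 6 → ℝ)), curve (Γ y) 1 = σ (P y)
  firstReturn : ∀ᶠ y in 𝓝 (h₀, (0 : Fin 6 → ℝ)), IsFirstReturn y.2 σ y.1 (P y)

theorem IsCrossSection.nonempty_returnData {σ : ℝ → ℝ × ℝ} (hσ : IsCrossSection σ) {h₀ : ℝ}
    (hh₀ : 0 < h₀) : Nonempty (ReturnData σ h₀) := by
  have hq : 0 < H (σ h₀) := by rwa [hσ.level h₀ hh₀]
  obtain ⟨T₀, c, hT₀, hc, hc0, hcT, hcne, hcH, hcI⟩ := exists_periodic_orbit hq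
  rw [hσ.level h₀ hh₀] at hcH hcI
  obtain ⟨Γ, P, τ, hΓ, hP, hτ, hΓ0, hP0, hτ0, hdef⟩ := exists_analytic_return hσ hh₀ hc hc0 hcT
  have hτp : ∀ᶠ y in 𝓝 (h₀, (0 : Fin 6 → ℝ)), 0 < τ y :=
    hτ.tendsto.eventually_const_lt (by rwa [hτ0])
  have hPp : ∀ᶠ y in 𝓝 (h₀, (0 : Fin 6 → ℝ)), 0 < P y :=
    hP.continuousAt.tendsto.eventually_const_lt (by rwa [hP0])
  have hcurve : ∀ s ∈ Icc (0 : ℝ) 1, curve (Γ (h₀, 0)) s = c (T₀ * s) := by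
    intro s hs
    rw [hΓ0, curve_rescale _ _ hs]
  have hno := eventually_no_early_return hσ hh₀ hΓ (hdef.mono fun _ h => h.1) hτp hPp
    (hdef.mono fun _ h => h.2) (by rw [hcurve 0 (by simp), mul_zero, hc0])
    (by rw [hcurve 1 (by simp), mul_one, hcT])
    (fun s hs => by
      rw [hcurve s (Ioo_subset_Icc_self hs)]
      exact hcne _ ⟨mul_pos hT₀ hs.1, mul_lt_of_lt_one_right hT₀ hs.2⟩)
    (fun s hs => by rw [hcurve s hs, hcH])
  exact ⟨⟨T₀, c, Γ, P, τ, hT₀, hc, hcT.trans hc0.symm, hcH, hcI, hΓ, hP, hτ, hΓ0, hP0, hτ0,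
    hdef.mono fun _ h => h.1, hdef.mono fun _ h => h.2, by
      filter_upwards [hdef, hτp, hPp, hno] with y h1 h2 h3 h4
      exact isFirstReturn_of_defect h3 h2 h1.1 h1.2 h4⟩⟩

/-- Existence and uniqueness of the first return, and analyticity of the displacement function. -/
theorem existsUnique_firstReturn_and_analyticAt {lam : Fin 6 → ℝ → ℝ}
    (hlam : ∀ j, AnalyticAt ℝ (lam j) 0) (hlam0 : ∀ j, lam j 0 = 0)
    {σ : ℝ → ℝ × ℝ} (hσ : IsCrossSection σ) {h : ℝ} (hh : 0 < h) :
    (∀ᶠ p : ℝ × ℝ in 𝓝 (h, 0), ∃! h' : ℝ, IsFirstReturn (fun j => lam j p.2) σ p.1 h') ∧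
      AnalyticAt ℝ (fun p : ℝ × ℝ => displacement lam σ p.1 p.2) (h, 0) := by
  obtain ⟨R⟩ := hσ.nonempty_returnData hh
  have hpar : AnalyticAt ℝ (fun p : ℝ × ℝ => (p.1, fun j => lam j p.2)) (h, 0) :=
    analyticAt_fst.prod (AnalyticAt.pi fun j => (hlam j).comp_of_eq analyticAt_snd rfl)
  have hbase : ((h, fun j => lam j 0) : ℝ × (Fin 6 → ℝ)) = (h, 0) := by
    simp only [hlam0]
    rfl
  have hev : ∀ᶠ p : ℝ × ℝ in 𝓝 (h, 0),
      IsFirstReturn (fun j => lam j p.2) σ p.1 (R.P (p.1, fun j => lam j p.2)) := by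
    have ht := hpar.continuousAt.tendsto
    rw [hbase] at ht
    exact ht.eventually R.firstReturn
  refine ⟨?_, ?_⟩
  · filter_upwards [hev] with p hp
    exact ⟨_, hp, fun _ h' => h'.unique hσ hp⟩
  · refine ((R.P_an.comp_of_eq hpar hbase).sub analyticAt_fst).congr ?_
    filter_upwards [hev] with p hp
    exact (displacement_eq hσ hp).symm

/-! ### The leading term of the displacement. -/

lemma curve_rescale_integral {c : C(ℝ, ℝ × ℝ)} {T : ℝ} (f : ℝ × ℝ → ℝ) :
    T * ∫ s in (0 : ℝ)..1, f (curve (rescale c T) s) = ∫ t in (0 : ℝ)..T, f (c t) := by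
  have h1 : ∫ s in (0 : ℝ)..1, f (curve (rescale c T) s) = ∫ s in (0 : ℝ)..1, f (c (T * s)) := by
    refine intervalIntegral.integral_congr fun s hs => ?_
    rw [uIcc_of_le zero_le_one] at hs
    simp only [curve_rescale c T hs]
  rw [h1]
  have := intervalIntegral.mul_integral_comp_mul_left (f := fun t => f (c t)) (a := 0) (b := 1) T
  rw [this, mul_zero, mul_one]

/-- The integral of a function along the trajectory depends continuously on the trajectory. -/
lemma continuous_integral_curve {f : ℝ → ℝ × ℝ → ℝ}
    (hf : Continuous fun u : ℝ × (ℝ × ℝ) => f u.1 u.2) :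
    Continuous fun u : ℝ × PathPair =>
      ∫ s in (0 : ℝ)..1, f u.1 (curve u.2 s) := by
  refine intervalIntegral.continuous_parametric_intervalIntegral_of_continuous' ?_ 0 1
  have h1 : Continuous fun z : (ℝ × PathPair) × ℝ =>
      curve z.1.2 z.2 :=
    continuous_curve_uncurry.comp (by fun_prop :
      Continuous fun z : (ℝ × PathPair) × ℝ => (z.1.2, z.2))
  exact hf.comp ((by fun_prop : Continuous fun z :
    (ℝ × PathPair) × ℝ => z.1.1).prodMk h1)

lemma tendsto_integral_curve {f : ℝ → ℝ × ℝ → ℝ}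
    (hf : Continuous fun u : ℝ × (ℝ × ℝ) => f u.1 u.2)
    {c : C(ℝ, ℝ × ℝ)} {T : ℝ} {a : Filter ℝ} {μ τ : ℝ → ℝ}
    {γ : ℝ → PathPair} (hμ : Tendsto μ a (𝓝 0))
    (hτ : Tendsto τ a (𝓝 T)) (hγ : Tendsto γ a (𝓝 (rescale c T))) :
    Tendsto (fun ε => τ ε * ∫ s in (0 : ℝ)..1, f (μ ε) (curve (γ ε) s)) a
      (𝓝 (∫ t in (0 : ℝ)..T, f 0 (c t))) := by
  rw [← curve_rescale_integral]
  exact hτ.mul (((continuous_integral_curve hf).tendsto (0, rescale c T)).comp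
    (hμ.prodMk_nhds hγ))

/-- The `j`-th monomial of the perturbation. -/
def pertMonomial (j : Fin 6) (p : ℝ × ℝ) : ℝ := pert (Pi.single j 1) p

lemma pert_eq_sum (l : Fin 6 → ℝ) (p : ℝ × ℝ) : pert l p = ∑ j, l j * pertMonomial j p := by
  simp [pertMonomial, pert, Fin.sum_univ_six, Pi.single_apply]

/-- The integrand of `∫ y² dt` times a monomial of the perturbation, with its correction. -/
def correctedMonomial (j : Fin 6) (μ : ℝ) (p : ℝ × ℝ) : ℝ :=
  (1 - 3 * μ * p.1 * p.2 + μ ^ 2 * secondDensity p) * (pertMonomial j p * p.2 ^ 2)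

lemma continuous_correctedMonomial (j : Fin 6) :
    Continuous fun u : ℝ × (ℝ × ℝ) => correctedMonomial j u.1 u.2 := by
  have h1 := continuous_pert (Pi.single j 1)
  have h2 := continuous_secondDensity
  unfold correctedMonomial pertMonomial
  fun_prop

/-- The increment of the corrected energy along a trajectory. -/
lemma correctedEnergy_sub {T μ : ℝ} {ξ : ℝ × ℝ} {l δ : Fin 6 → ℝ}
    {γ : PathPair} (hd : defect ((T, ξ, l), γ) = 0)
    (hl : ∀ j, l j = nullDir j * μ + δ j) :
    (H (curve γ 1) - μ * firstPrimitive (curve γ 1) - μ ^ 2 * secondPrimitive (curve γ 1)) -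
      (H ξ - μ * firstPrimitive ξ - μ ^ 2 * secondPrimitive ξ) =
    μ ^ 3 * (T * ∫ s in (0 : ℝ)..1,
      secondDensity (curve γ s) * pert nullDir (curve γ s) * (curve γ s).2 ^ 2) +
    ∑ j, δ j * (T * ∫ s in (0 : ℝ)..1, correctedMonomial j μ (curve γ s)) := by
  have hc := continuous_curve γ
  have hsd := continuous_secondDensity
  have hpn := continuous_pert nullDir
  have hder := fun s (hs : s ∈ Icc (0 : ℝ) 1) =>
    hasDerivWithinAt_correctedEnergy (hasDerivWithinAt_curve hd hs) hl
  have i1 : Continuous fun s => secondDensity (curve γ s) * pert nullDir (curve γ s) *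
      (curve γ s).2 ^ 2 := by fun_prop
  have i2 : ∀ j, Continuous fun s => correctedMonomial j μ (curve γ s) := fun j =>
    (continuous_correctedMonomial j).comp (continuous_const.prodMk hc)
  have heq : ∀ s, T * (μ ^ 3 *
      (secondDensity (curve γ s) * pert nullDir (curve γ s) * (curve γ s).2 ^ 2) +
      (1 - 3 * μ * (curve γ s).1 * (curve γ s).2 + μ ^ 2 * secondDensity (curve γ s)) *
        (pert δ (curve γ s) * (curve γ s).2 ^ 2)) =
      T * (μ ^ 3 *
        (secondDensity (curve γ s) * pert nullDir (curve γ s) * (curve γ s).2 ^ 2) +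
        ∑ j, δ j * correctedMonomial j μ (curve γ s)) := by
    intro s
    simp only [pert_eq_sum δ, correctedMonomial, Finset.sum_mul, Finset.mul_sum]
    congr 2
    refine Finset.sum_congr rfl fun j _ => ?_
    ring
  simp only [heq] at hder
  have h0 := intervalIntegral.integral_eq_sub_of_hasDerivAt_of_le zero_le_one
    (fun s hs => (hder s hs).continuousWithinAt)
    (fun s hs => (hder s (Ioo_subset_Icc_self hs)).hasDerivAt (Icc_mem_nhds hs.1 hs.2))
    ((by fun_prop : Continuous _).intervalIntegrable _ _)
  rw [curve_zero_of_defect hd] at h0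
  rw [← h0, intervalIntegral.integral_const_mul, intervalIntegral.integral_add
    ((i1.const_mul _).intervalIntegrable _ _)
    ((by fun_prop : Continuous _).intervalIntegrable _ _),
    intervalIntegral.integral_finsetSum (fun j _ => ((i2 j).const_mul _).intervalIntegrable _ _)]
  simp only [intervalIntegral.integral_const_mul, Finset.mul_sum, mul_add]
  congr 1
  · ring
  · refine Finset.sum_congr rfl fun j _ => ?_
    ring

lemma comp_sub_eq_mul_dslope (σ : ℝ → ℝ × ℝ) (f : ℝ × ℝ → ℝ) (h x : ℝ) :
    f (σ x) - f (σ h) = (x - h) * dslope (fun x => f (σ x)) h x := by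
  simpa using (sub_smul_dslope (fun x => f (σ x)) h x).symm

lemma IsCrossSection.continuousAt_dslope {σ : ℝ → ℝ × ℝ} (hσ : IsCrossSection σ) {f : ℝ × ℝ → ℝ}
    (hf : Differentiable ℝ f) {h : ℝ} (hh : 0 < h) :
    ContinuousAt (dslope (fun x => f (σ x)) h) h :=
  continuousAt_dslope_same.2
    ((hf (σ h)).comp h (hσ.hasDerivAt hh).differentiableAt)

/-- The leading term of the displacement function, if `λ(ε)` is, up to order `n`, a multiple of
`nullDir` which is of order at least `n / 3`. -/
theorem tendsto_displacement_div_pow {lam : Fin 6 → ℝ → ℝ}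
    (hlam : ∀ j, ContinuousAt (lam j) 0) (hlam0 : ∀ j, lam j 0 = 0)
    {σ : ℝ → ℝ × ℝ} (hσ : IsCrossSection σ) {n : ℕ} {ρ : Fin 6 → ℝ} {κ : ℝ}
    (hρ : ∀ j, Tendsto (fun ε => (lam j ε - nullDir j * lam 2 ε) / ε ^ n) (𝓝[≠] 0) (𝓝 (ρ j)))
    (hκ : Tendsto (fun ε => lam 2 ε ^ 3 / ε ^ n) (𝓝[≠] 0) (𝓝 κ)) {h : ℝ} (hh : 0 < h) :
    Tendsto (fun ε => displacement lam σ h ε / ε ^ n) (𝓝[≠] 0)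
      (𝓝 (linearPart ρ h + κ * cubicPart 1 h)) := by
  obtain ⟨R⟩ := hσ.nonempty_returnData hh
  set y : ℝ → ℝ × (Fin 6 → ℝ) := fun ε => (h, fun j => lam j ε) with hy
  have hy0 : Tendsto y (𝓝[≠] 0) (𝓝 (h, 0)) := by
    have h1 : ContinuousAt y 0 := continuousAt_const.prodMk (continuousAt_pi.2 hlam)
    have h2 : y 0 = (h, 0) := by
      simp only [hy, hlam0]
      rfl
    rw [← h2]
    exact h1.tendsto.mono_left nhdsWithin_le_nhds
  have hμ0 : Tendsto (lam 2) (𝓝[≠] 0) (𝓝 0) := by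
    have := (hlam 2).tendsto.mono_left (nhdsWithin_le_nhds (s := {0}ᶜ))
    rwa [hlam0] at this
  have hΓ : Tendsto (fun ε => R.Γ (y ε)) (𝓝[≠] 0) (𝓝 (rescale R.c R.T₀)) := by
    have := R.Γ_cont.tendsto.comp hy0
    rwa [R.Γ_base] at this
  have hτ : Tendsto (fun ε => R.τ (y ε)) (𝓝[≠] 0) (𝓝 R.T₀) := by
    have := R.τ_cont.tendsto.comp hy0
    rwa [R.τ_base] at this
  have hP : Tendsto (fun ε => R.P (y ε)) (𝓝[≠] 0) (𝓝 h) := by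
    have := R.P_an.continuousAt.tendsto.comp hy0
    rwa [R.P_base] at this
  have hA : Tendsto (fun ε => R.τ (y ε) * ∫ s in (0 : ℝ)..1, secondDensity (curve (R.Γ (y ε)) s) *
      pert nullDir (curve (R.Γ (y ε)) s) * (curve (R.Γ (y ε)) s).2 ^ 2) (𝓝[≠] 0)
      (𝓝 (cubicPart 1 h)) := by
    have hsd := continuous_secondDensity
    have hpn := continuous_pert nullDir
    rw [← integral_secondDensity R.orbit R.c_period R.c_level R.c_integral]
    exact tendsto_integral_curve
      (f := fun _ p => secondDensity p * pert nullDir p * p.2 ^ 2) (by fun_prop) hμ0 hτ hΓ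
  have hB : ∀ j, Tendsto (fun ε => R.τ (y ε) * ∫ s in (0 : ℝ)..1,
      correctedMonomial j (lam 2 ε) (curve (R.Γ (y ε)) s)) (𝓝[≠] 0)
      (𝓝 (linearPart (Pi.single j 1) h)) := by
    intro j
    rw [← integral_pert R.orbit R.c_period R.c_level R.c_integral]
    have := tendsto_integral_curve (continuous_correctedMonomial j) hμ0 hτ hΓ
    simpa [correctedMonomial, pertMonomial] using this
  have hlin : linearPart ρ h = ∑ j, ρ j * linearPart (Pi.single j 1) h := by
    simp only [Fin.sum_univ_six, linearPart, Pi.single_apply]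
    simp
    ring
  have hfp : Differentiable ℝ firstPrimitive := by
    unfold firstPrimitive
    fun_prop
  have hsp : Differentiable ℝ secondPrimitive := by
    unfold secondPrimitive H
    fun_prop
  set k₁ := dslope (fun x => firstPrimitive (σ x)) h
  set k₂ := dslope (fun x => secondPrimitive (σ x)) h
  -- The ends of the turn lie on `σ`, where the corrected energy differs by `(P - h) * N`; the
  -- divided differences stay bounded, so `N` tends to `1`.
  set N : ℝ → ℝ := fun ε => 1 - lam 2 ε * k₁ (R.P (y ε)) - lam 2 ε ^ 2 * k₂ (R.P (y ε)) with hN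
  have hN1 : Tendsto N (𝓝[≠] 0) (𝓝 1) := by
    have e1 := ((hσ.continuousAt_dslope hfp hh).tendsto.comp hP)
    have e2 := ((hσ.continuousAt_dslope hsp hh).tendsto.comp hP)
    have := (tendsto_const_nhds (x := (1 : ℝ))).sub (hμ0.mul e1) |>.sub ((hμ0.pow 2).mul e2)
    simpa using this
  have hlim : Tendsto (fun ε => (lam 2 ε ^ 3 / ε ^ n * (R.τ (y ε) * ∫ s in (0 : ℝ)..1,
      secondDensity (curve (R.Γ (y ε)) s) * pert nullDir (curve (R.Γ (y ε)) s) *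
        (curve (R.Γ (y ε)) s).2 ^ 2) +
      ∑ j, (lam j ε - nullDir j * lam 2 ε) / ε ^ n * (R.τ (y ε) * ∫ s in (0 : ℝ)..1,
        correctedMonomial j (lam 2 ε) (curve (R.Γ (y ε)) s))) / N ε) (𝓝[≠] 0)
      (𝓝 (linearPart ρ h + κ * cubicPart 1 h)) := by
    have := ((hκ.mul hA).add (tendsto_finsetSum Finset.univ
      fun j _ => (hρ j).mul (hB j))).div hN1 one_ne_zero
    rwa [div_one, ← hlin, add_comm] at this
  refine hlim.congr' ?_
  filter_upwards [hy0.eventually R.defect_eq, hy0.eventually R.end_eq,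
    hy0.eventually R.firstReturn, hN1.eventually_ne one_ne_zero] with ε h1 h2 h3 h4
  rw [displacement_eq hσ h3, div_eq_iff h4]
  have key := correctedEnergy_sub h1 (μ := lam 2 ε)
    (δ := fun j => lam j ε - nullDir j * lam 2 ε) (fun j => by simp [hy])
  have hPpos := h3.1
  rw [h2, hσ.level _ hPpos, hσ.level (y ε).1 hh] at key
  have s1 : _ = _ * k₁ _ := comp_sub_eq_mul_dslope σ firstPrimitive h (R.P (y ε))
  have s2 : _ = _ * k₂ _ := comp_sub_eq_mul_dslope σ secondPrimitive h (R.P (y ε))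
  have e1 : ∀ a b : ℝ, a / ε ^ n * b = a * b / ε ^ n := fun a b => by ring
  have hy1 : (y ε).1 = h := rfl
  simp only [e1, ← Finset.sum_div, ← add_div, ← key, hN, hy1]
  congr 1
  linear_combination -lam 2 ε * s1 - lam 2 ε ^ 2 * s2

/-! ### Taylor coefficients as limits of quotients. -/

lemma taylorCoeff_zero (f : ℝ → ℝ) : taylorCoeff f 0 = f 0 := by
  simp [taylorCoeff]

lemma taylorCoeff_sub_const_mul {f g : ℝ → ℝ} (hf : AnalyticAt ℝ f 0) (hg : AnalyticAt ℝ g 0)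
    (a : ℝ) (k : ℕ) :
    taylorCoeff (fun x => f x - a * g x) k = taylorCoeff f k - a * taylorCoeff g k := by
  have h1 : iteratedDeriv k (fun x => f x - a * g x) 0 =
      iteratedDeriv k f 0 - a * iteratedDeriv k g 0 := by
    rw [iteratedDeriv_fun_sub hf.contDiffAt (contDiffAt_const.mul hg.contDiffAt),
      iteratedDeriv_const_mul_field]
  rw [taylorCoeff, h1, taylorCoeff, taylorCoeff]
  ring

lemma tendsto_div_pow_of_taylorCoeff {f : ℝ → ℝ} (hf : AnalyticAt ℝ f 0) {n : ℕ}
    (h : ∀ k < n, taylorCoeff f k = 0) :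
    Tendsto (fun x => f x / x ^ n) (𝓝[≠] 0) (𝓝 (taylorCoeff f n)) := by
  have h1 := hf.hasFPowerSeriesAt.isBigO_sub_partialSum_pow (n + 1)
  have h2 : ∀ x : ℝ, (FormalMultilinearSeries.ofScalars ℝ
      (fun n => iteratedDeriv n f 0 / n.factorial)).partialSum (n + 1) x =
        taylorCoeff f n * x ^ n := by
    intro x
    rw [FormalMultilinearSeries.partialSum, Finset.sum_range_succ, Finset.sum_eq_zero]
    · simp [taylorCoeff, mul_comm]
    · intro k hk
      have := h k (Finset.mem_range.1 hk)
      rw [taylorCoeff] at this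
      simp [this]
  simp only [zero_add, h2] at h1
  have h3 : Tendsto (fun x : ℝ => (f x - taylorCoeff f n * x ^ n) / x ^ n) (𝓝[≠] 0) (𝓝 0) := by
    have h4 : (fun x : ℝ => ‖x‖ ^ (n + 1)) =o[𝓝[≠] 0] fun x => x ^ n := by
      have h5 : (fun x : ℝ => x ^ (n + 1)) =o[𝓝 0] fun x => x ^ n :=
        Asymptotics.isLittleO_pow_pow (Nat.lt_succ_self n)
      refine (h5.mono nhdsWithin_le_nhds).norm_left.congr_left fun x => ?_
      simp
    exact ((h1.mono nhdsWithin_le_nhds).trans_isLittleO h4).tendsto_div_nhds_zero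
  have h6 := h3.add_const (taylorCoeff f n)
  rw [zero_add] at h6
  refine h6.congr' ?_
  filter_upwards [self_mem_nhdsWithin] with x hx
  have hx : x ≠ 0 := hx
  field_simp
  ring

lemma tendsto_mul_pow_zero {g : ℝ → ℝ} {c : ℝ} (hg : Tendsto g (𝓝[≠] 0) (𝓝 c)) {k : ℕ}
    (hk : k ≠ 0) : Tendsto (fun x => g x * x ^ k) (𝓝[≠] 0) (𝓝 0) := by
  have h1 : Tendsto (fun x : ℝ => x ^ k) (𝓝[≠] 0) (𝓝 0) := by
    have := (continuous_pow (M := ℝ) k).tendsto 0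
    rw [zero_pow hk] at this
    exact this.mono_left nhdsWithin_le_nhds
  simpa using hg.mul h1

/-- The existence of a finite limit already forces all lower coefficients to vanish: multiplying by
`x ^ (n - k)` sends the limit to `0`. -/
lemma taylorCoeff_eq_of_tendsto {f : ℝ → ℝ} (hf : AnalyticAt ℝ f 0) {n : ℕ} {c : ℝ}
    (h : Tendsto (fun x => f x / x ^ n) (𝓝[≠] 0) (𝓝 c)) : taylorCoeff f n = c := by
  have hlow : ∀ k < n, taylorCoeff f k = 0 := by
    intro k
    induction k using Nat.strong_induction_on with
    | _ k ih =>
      intro hk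
      refine tendsto_nhds_unique
        (tendsto_div_pow_of_taylorCoeff hf fun i hi => ih i hi (hi.trans hk)) ?_
      refine (tendsto_mul_pow_zero h (Nat.sub_ne_zero_of_lt hk)).congr' ?_
      filter_upwards [self_mem_nhdsWithin] with x hx
      have hx : x ≠ 0 := hx
      rw [div_mul_eq_mul_div, div_eq_div_iff (pow_ne_zero _ hx) (pow_ne_zero _ hx), mul_assoc,
        ← pow_add, Nat.sub_add_cancel hk.le]
  exact tendsto_nhds_unique (tendsto_div_pow_of_taylorCoeff hf hlow) h

/-! ### Independence of the basic integrals. -/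

/-- Powers with coefficients which are bounded, and bounded away from `0`, are independent. -/
lemma coeff_eq_zero_of_bounded {b B : ℝ} (hb : 0 < b) {w : ℕ → ℝ → ℝ}
    (hw : ∀ i t, 1 ≤ t → b ≤ w i t ∧ w i t ≤ B) (a : ℕ → ℝ) (n : ℕ)
    (h : ∀ t, 1 ≤ t → ∑ i ∈ Finset.range n, a i * w i t * t ^ i = 0) : ∀ i < n, a i = 0 := by
  induction n with
  | zero => simp
  | succ n ih =>
    have han : a n = 0 := by
      by_contra hne
      have hpos : 0 < |a n| * b := mul_pos (abs_pos.2 hne) hb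
      set C := ∑ i ∈ Finset.range n, |a i| * B
      -- The top term is at least `|a n| b tⁿ` in size and the others add up to at most `C tⁿ⁻¹`;
      -- the factor `t` is moved to the left to avoid the exponent `n - 1`.
      have hle : ∀ t : ℝ, 1 ≤ t → |a n| * b * t ≤ C := by
        intro t ht
        have ht0 : 0 < t := by linarith
        have h1 := h t ht
        rw [Finset.sum_range_succ] at h1
        have h2 : |a n| * b * t ^ n ≤ |a n * w n t * t ^ n| := by
          rw [abs_mul, abs_mul, abs_of_pos (pow_pos ht0 n)]
          gcongr
          exact (hw n t ht).1.trans (le_abs_self _)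
        have h3 : |a n * w n t * t ^ n| * t ≤ C * t ^ n := by
          have : a n * w n t * t ^ n = -∑ i ∈ Finset.range n, a i * w i t * t ^ i := by linarith
          rw [this, abs_neg, Finset.sum_mul]
          refine (mul_le_mul_of_nonneg_right (Finset.abs_sum_le_sum_abs _ _) ht0.le).trans ?_
          rw [Finset.sum_mul]
          refine Finset.sum_le_sum fun i hi => ?_
          have h4 := hw i t ht
          rw [abs_mul, abs_mul, abs_of_pos (pow_pos ht0 i), abs_of_pos (hb.trans_le h4.1),
            mul_assoc _ (t ^ i), ← pow_succ]
          have h5 : t ^ (i + 1) ≤ t ^ n := pow_le_pow_right₀ ht (Finset.mem_range.1 hi)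
          have h6 : 0 ≤ B := hb.le.trans (h4.1.trans h4.2)
          gcongr
          exact h4.2
        have h7 : |a n| * b * t * t ^ n ≤ C * t ^ n := by
          calc |a n| * b * t * t ^ n = |a n| * b * t ^ n * t := by ring
            _ ≤ |a n * w n t * t ^ n| * t := by gcongr
            _ ≤ C * t ^ n := h3
        exact le_of_mul_le_mul_right h7 (pow_pos ht0 n)
      have h1 := hle (max 1 (C / (|a n| * b) + 1)) (le_max_left _ _)
      have h2 := le_max_right 1 (C / (|a n| * b) + 1)
      have h3 : C < |a n| * b * (C / (|a n| * b) + 1) := by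
        rw [mul_add, mul_div_cancel₀ _ hpos.ne']
        linarith
      nlinarith
    intro i hi
    rcases Nat.lt_succ_iff_lt_or_eq.1 hi with hi | rfl
    · refine ih (fun t ht => ?_) i hi
      have := h t ht
      rwa [Finset.sum_range_succ, han, zero_mul, zero_mul, add_zero] at this
    · exact han

lemma I₀_pos {h : ℝ} (hh : 0 < h) : 0 < I₀ h := by
  have hy : Continuous (yPlus h) := by unfold yPlus; fun_prop
  have ha : 0 < xMax h := by
    rw [xMax, Real.sqrt_pos]
    have : 1 < √(1 + 4 * h) := by
      rw [Real.lt_sqrt zero_le_one]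
      linarith
    linarith
  have hpos : 0 < ∫ x in (-xMax h)..(xMax h), yPlus h x := by
    refine intervalIntegral.integral_pos (by linarith) hy.continuousOn
      (fun x _ => Real.sqrt_nonneg _) ⟨0, ⟨by linarith, ha.le⟩, ?_⟩
    rw [yPlus, Real.sqrt_pos]
    simpa using hh
  rw [I₀, ovalIntegral, intervalIntegral.integral_neg,
    intervalIntegral.integral_symm (-xMax h) (xMax h)]
  linarith

/-- The growth of the quotient of the two basic integrals. -/
lemma basic_integrals_bounds {t : ℝ} (ht : 1 ≤ t) :
    2 / 11 * t * I₀ (t ^ 2) ≤ I₂ (t ^ 2) ∧ I₂ (t ^ 2) ≤ 2 * t * I₀ (t ^ 2) := by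
  set h := t ^ 2 with hh
  have hpos : 0 < h := by positivity
  have hq : H (0, √(2 * h)) = h := by
    simp only [H, Real.sq_sqrt (by positivity : 0 ≤ 2 * h)]
    ring
  obtain ⟨T, c, hT, hc, hc0, hcT, -, hcH, hcI⟩ :=
    exists_periodic_orbit (q := (0, √(2 * h))) (by rwa [hq])
  rw [hq] at hcH hcI
  -- Because `x⁴/4 ≤ H = t²`.
  have hx : ∀ s, (c s).1 ^ 2 ≤ 2 * t := by
    intro s
    have h1 := hcH s
    unfold H at h1
    nlinarith [sq_nonneg (c s).2, sq_nonneg (c s).1, sq_nonneg ((c s).1 ^ 2)]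
  have e0 : ∫ s in (0 : ℝ)..T, (c s).2 ^ 2 = I₀ h := by
    simpa using integral_basic hcI 0 1
  have e2 : ∫ s in (0 : ℝ)..T, (c s).1 ^ 2 * (c s).2 ^ 2 = I₂ h := by
    simpa using integral_basic hcI 1 0
  have e4 := integral_quartic hc (hcT.trans hc0.symm) hcH hcI
  have b2 : I₂ h ≤ 2 * t * I₀ h := by
    rw [← e2, ← e0, ← intervalIntegral.integral_const_mul]
    refine intervalIntegral.integral_mono_on hT.le
      ((by fun_prop : Continuous _).intervalIntegrable _ _)
      ((by fun_prop : Continuous _).intervalIntegrable _ _) fun s _ => ?_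
    exact mul_le_mul_of_nonneg_right (hx s) (sq_nonneg _)
  have b4 : -4 * I₂ h + 2 * h * I₀ h ≤ 7 * t * I₂ h := by
    rw [← e4, ← e2, ← intervalIntegral.integral_const_mul]
    refine intervalIntegral.integral_mono_on hT.le
      ((by fun_prop : Continuous _).intervalIntegrable _ _)
      ((by fun_prop : Continuous _).intervalIntegrable _ _) fun s _ => ?_
    have := mul_le_mul_of_nonneg_right (hx s)
      (mul_nonneg (sq_nonneg (c s).1) (sq_nonneg (c s).2))
    nlinarith
  have hI2 : 0 ≤ I₂ h := by
    rw [← e2]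
    exact intervalIntegral.integral_nonneg hT.le fun s _ => by positivity
  refine ⟨?_, b2⟩
  -- Here `11 = 7 + 4`, since `4 ≤ 4t`.
  have h1 : 2 * h * I₀ h ≤ 11 * t * I₂ h := by nlinarith
  have h2 : t * (2 * t * I₀ h) ≤ t * (11 * I₂ h) := by
    calc t * (2 * t * I₀ h) = 2 * h * I₀ h := by rw [hh]; ring
      _ ≤ 11 * t * I₂ h := h1
      _ = _ := by ring
  have h3 := le_of_mul_le_mul_left h2 (by linarith)
  linarith

/-- `I₀` and `I₂` are independent over the quadratic polynomials. -/
lemma basic_integrals_independent {p₀ p₁ p₂ q₀ q₁ q₂ : ℝ}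
    (h : ∀ h, 0 < h → (p₂ * h ^ 2 + p₁ * h + p₀) * I₂ h + (q₂ * h ^ 2 + q₁ * h + q₀) * I₀ h = 0) :
    (p₀ = 0 ∧ p₁ = 0 ∧ p₂ = 0) ∧ q₀ = 0 ∧ q₁ = 0 ∧ q₂ = 0 := by
  -- With `h = t²` and after division by `I₀`, the `q` terms carry even powers of `t`. The quotient
  -- `I₂ / I₀` is comparable to `t`, so the `p` terms fill the odd powers.
  set a : ℕ → ℝ := fun i => [q₀, p₀, q₁, p₁, q₂, p₂].getD i 0 with ha
  set w : ℕ → ℝ → ℝ := fun i t => if Even i then 1 else I₂ (t ^ 2) / (t * I₀ (t ^ 2)) with hw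
  have key := coeff_eq_zero_of_bounded (b := 2 / 11) (B := 2) (by norm_num) (w := w) ?_ a 6 ?_
  · have k0 := key 0 (by norm_num)
    have k1 := key 1 (by norm_num)
    have k2 := key 2 (by norm_num)
    have k3 := key 3 (by norm_num)
    have k4 := key 4 (by norm_num)
    have k5 := key 5 (by norm_num)
    exact ⟨⟨k1, k3, k5⟩, k0, k2, k4⟩
  · intro i t ht
    have hI := I₀_pos (h := t ^ 2) (by positivity)
    have hb := basic_integrals_bounds ht
    have htI : 0 < t * I₀ (t ^ 2) := by positivity
    simp only [hw]
    split_ifs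
    · norm_num
    · rw [le_div_iff₀ htI, div_le_iff₀ htI]
      constructor <;> linarith [hb.1, hb.2]
  · intro t ht
    have hI := I₀_pos (h := t ^ 2) (by positivity)
    have h1 := h (t ^ 2) (by positivity)
    have ht0 : t ≠ 0 := by positivity
    have h2 : I₂ (t ^ 2) = I₂ (t ^ 2) / (t * I₀ (t ^ 2)) * (t * I₀ (t ^ 2)) := by
      field_simp
    rw [h2] at h1
    have h3 : Even 4 := by decide
    have h4 : ¬ Even 5 := by decide
    have h5 : ¬ Even 3 := by decide
    simp [Finset.sum_range_succ, ha, hw, h3, h4, h5]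
    refine (mul_eq_zero.1 (?_ : _ * I₀ (t ^ 2) = 0)).resolve_right hI.ne'
    rw [← h1]
    ring

/-! ### Induction on the order. -/

lemma linearPart_sub_nullDir (c : Fin 6 → ℝ) (a h : ℝ) :
    linearPart (fun j => c j - nullDir j * a) h = linearPart c h := by
  simp only [linearPart]
  simp [nullDir]
  ring

lemma cubicPart_eq (s h : ℝ) : cubicPart s h = s ^ 3 * cubicPart 1 h := by
  simp only [cubicPart]
  ring

/-- The condition `c 2 = 0` picks a complement of the kernel line. The `h² I₂` coefficient occurs in
the cubic part only and gives `κ = 0`; the remaining system is then triangular. -/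
lemma eq_zero_of_linearPart_add_cubicPart {c : Fin 6 → ℝ} {κ : ℝ} (hc2 : c 2 = 0)
    (h : ∀ h, 0 < h → linearPart c h + κ * cubicPart 1 h = 0) : (∀ j, c j = 0) ∧ κ = 0 := by
  have key := basic_integrals_independent
    (p₂ := -(8 / 1001 * 308) * κ) (p₁ := 4 / 3 * c 5 - 320 / 231 * c 4 - 8 / 1001 * 181 * κ)
    (p₀ := 32 / 21 * c 5 - 40 / 231 * c 4 - 8 / 7 * c 3 - 3 / 7 * c 2 + c 1 - 8 / 1001 * 24 * κ)
    (q₂ := 240 / 77 * c 4 + 8 / 1001 * 80 * κ)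
    (q₁ := -(16 / 21) * c 5 + 20 / 231 * c 4 + 4 / 7 * c 3 + 12 / 7 * c 2 + 8 / 1001 * 12 * κ)
    (q₀ := c 0) (fun x hx => by
      rw [← h x hx, linearPart, cubicPart]
      ring)
  obtain ⟨⟨h1, h2, h3⟩, h4, h5, h6⟩ := key
  have hκ : κ = 0 := by linarith
  have h4' : c 4 = 0 := by linarith
  have h5' : c 5 = 0 := by linarith
  have h3' : c 3 = 0 := by linarith
  have h1' : c 1 = 0 := by linarith
  refine ⟨fun j => ?_, hκ⟩
  fin_cases j <;> assumption

section Main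

variable {lam : Fin 6 → ℝ → ℝ} {σ : ℝ → ℝ × ℝ}

/-- The coefficient of the cubic term in `M_n`. -/
def cubicCoeff (lam : Fin 6 → ℝ → ℝ) (n : ℕ) : ℝ :=
  if 3 ∣ n then taylorCoeff (lam 2) (n / 3) ^ 3 else 0

/-- If `3` does not divide `n`, then `λ₃` has order at least `n / 3 + 1` (integer division), so its
cube has order greater than `n` and contributes nothing. -/
lemma tendsto_cube_div_pow (hlam : AnalyticAt ℝ (lam 2) 0) {n : ℕ}
    (h : ∀ k, 3 * k < n → taylorCoeff (lam 2) k = 0) :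
    Tendsto (fun ε => lam 2 ε ^ 3 / ε ^ n) (𝓝[≠] 0) (𝓝 (cubicCoeff lam n)) := by
  rw [cubicCoeff]
  split_ifs with hn
  · obtain ⟨m, rfl⟩ := hn
    rw [Nat.mul_div_cancel_left m (by norm_num)]
    have := (tendsto_div_pow_of_taylorCoeff hlam (n := m) fun k hk => h k (by omega)).pow 3
    refine this.congr fun x => ?_
    rw [div_pow, ← pow_mul, mul_comm m 3]
  · have := (tendsto_div_pow_of_taylorCoeff hlam (n := n / 3 + 1) fun k hk => h k (by omega)).pow 3
    refine (tendsto_mul_pow_zero this (k := 3 * (n / 3 + 1) - n) (by omega)).congr' ?_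
    filter_upwards [self_mem_nhdsWithin] with x hx
    have hx : x ≠ 0 := hx
    rw [div_pow, ← pow_mul, div_mul_eq_mul_div, div_eq_div_iff (pow_ne_zero _ hx)
      (pow_ne_zero _ hx), mul_assoc, ← pow_add]
    congr 2
    omega

/-- The formula for `M_n`, if `λ(ε)` is, up to order `n`, a multiple of `nullDir` which is of
order at least `n / 3`. -/
lemma M_eq_of_taylorCoeff (hlam : ∀ j, AnalyticAt ℝ (lam j) 0) (hlam0 : ∀ j, lam j 0 = 0)
    (hσ : IsCrossSection σ) {n : ℕ}
    (h1 : ∀ k < n, ∀ j, taylorCoeff (lam j) k = nullDir j * taylorCoeff (lam 2) k)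
    (h2 : ∀ k, 3 * k < n → taylorCoeff (lam 2) k = 0) {h : ℝ} (hh : 0 < h) :
    M lam σ n h = linearPart (fun j => taylorCoeff (lam j) n) h +
      cubicCoeff lam n * cubicPart 1 h := by
  have han : AnalyticAt ℝ (displacement lam σ h) 0 := by
    have := (existsUnique_firstReturn_and_analyticAt hlam hlam0 hσ hh).2
    exact AnalyticAt.comp_of_eq (g := fun p : ℝ × ℝ => displacement lam σ p.1 p.2)
      (f := fun ε => (h, ε)) this (analyticAt_const.prod analyticAt_id) rfl
  -- The limit sees the coefficients of `δ`, which differ from those of `λ` by an element of the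
  -- kernel.
  rw [← linearPart_sub_nullDir _ (taylorCoeff (lam 2) n)]
  refine taylorCoeff_eq_of_tendsto han (tendsto_displacement_div_pow
    (fun j => (hlam j).continuousAt) hlam0 hσ (fun j => ?_) (tendsto_cube_div_pow (hlam 2) h2) hh)
  have ha : AnalyticAt ℝ (fun ε => lam j ε - nullDir j * lam 2 ε) 0 :=
    (hlam j).sub (analyticAt_const.mul (hlam 2))
  rw [← taylorCoeff_sub_const_mul (hlam j) (hlam 2)]
  refine tendsto_div_pow_of_taylorCoeff ha fun k hk => ?_
  rw [taylorCoeff_sub_const_mul (hlam j) (hlam 2), h1 k hk j, sub_self]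

/-- If `M_1, …, M_{n-1}` vanish, `λ(ε)` is, up to order `n`, a multiple of `nullDir` which is of
order at least `n / 3`. -/
lemma taylorCoeff_of_M_eq_zero (hlam : ∀ j, AnalyticAt ℝ (lam j) 0) (hlam0 : ∀ j, lam j 0 = 0)
    (hσ : IsCrossSection σ) (n : ℕ)
    (hM : ∀ k, 1 ≤ k → k < n → ∀ h, 0 < h → M lam σ k h = 0) :
    (∀ k < n, ∀ j, taylorCoeff (lam j) k = nullDir j * taylorCoeff (lam 2) k) ∧
      ∀ k, 3 * k < n → taylorCoeff (lam 2) k = 0 := by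
  induction n with
  | zero => simp
  | succ n ih =>
    obtain ⟨h1, h2⟩ := ih fun k hk hkn => hM k hk (hkn.trans (Nat.lt_succ_self n))
    have hn : (∀ j, taylorCoeff (lam j) n - nullDir j * taylorCoeff (lam 2) n = 0) ∧
        cubicCoeff lam n = 0 := by
      -- Order `0` is not covered by the hypothesis on `M`; it comes from `λ(0) = 0`.
      rcases Nat.eq_zero_or_pos n with rfl | hpos
      · simp [cubicCoeff, taylorCoeff_zero, hlam0]
      · refine eq_zero_of_linearPart_add_cubicPart
          (c := fun j => taylorCoeff (lam j) n - nullDir j * taylorCoeff (lam 2) n)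
          (by simp [nullDir]) fun h hh => ?_
        rw [linearPart_sub_nullDir, ← M_eq_of_taylorCoeff hlam hlam0 hσ h1 h2 hh]
        exact hM n hpos (Nat.lt_succ_self n) h hh
    constructor
    · intro k hk j
      rcases Nat.lt_succ_iff_lt_or_eq.1 hk with hk | rfl
      · exact h1 k hk j
      · exact sub_eq_zero.1 (hn.1 j)
    · intro k hk
      rcases Nat.lt_succ_iff_lt_or_eq.1 hk with hk | hk
      · exact h2 k hk
      -- The bound on the order of `λ₃` improves only when `n = 3k`, where the cubic coefficient is
      -- the cube of its `k`-th coefficient.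
      · have := hn.2
        rw [cubicCoeff, if_pos ⟨k, hk.symm⟩, ← hk, Nat.mul_div_cancel_left k (by norm_num)] at this
        exact pow_eq_zero_iff (by norm_num) |>.1 this

end Main

end GlobalCenter

end

theorem theorem3 (lam : Fin 6 → ℝ → ℝ)
    (hlam : ∀ j, AnalyticAt ℝ (lam j) 0) (hlam0 : ∀ j, lam j 0 = 0)
    (σ : ℝ → ℝ × ℝ) (hσ : GlobalCenter.IsCrossSection σ) :
    (∀ h : ℝ, 0 < h →
      (∀ᶠ p : ℝ × ℝ in 𝓝 (h, 0),
        ∃! h' : ℝ, GlobalCenter.IsFirstReturn (fun j => lam j p.2) σ p.1 h') ∧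
      AnalyticAt ℝ (fun p : ℝ × ℝ => GlobalCenter.displacement lam σ p.1 p.2) (h, 0)) ∧
    ∀ n : ℕ, 1 ≤ n →
      (∀ k : ℕ, 1 ≤ k → k < n → ∀ h : ℝ, 0 < h → GlobalCenter.M lam σ k h = 0) →
      (∀ m : ℕ, n = 3 * m → ∀ h : ℝ, 0 < h →
        GlobalCenter.M lam σ n h =
          GlobalCenter.linearPart (fun j => GlobalCenter.taylorCoeff (lam j) n) h +
            GlobalCenter.cubicPart (GlobalCenter.taylorCoeff (lam 2) m) h) ∧
      ((¬ ∃ m : ℕ, n = 3 * m) → ∀ h : ℝ, 0 < h →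
        GlobalCenter.M lam σ n h =
          GlobalCenter.linearPart (fun j => GlobalCenter.taylorCoeff (lam j) n) h) := by
  refine ⟨fun h hh => GlobalCenter.existsUnique_firstReturn_and_analyticAt hlam hlam0 hσ hh,
    fun n _ hM => ?_⟩
  obtain ⟨h1, h2⟩ := GlobalCenter.taylorCoeff_of_M_eq_zero hlam hlam0 hσ n hM
  refine ⟨fun m hm h hh => ?_, fun hn h hh => ?_⟩
  · rw [GlobalCenter.M_eq_of_taylorCoeff hlam hlam0 hσ h1 h2 hh, GlobalCenter.cubicCoeff,
      if_pos ⟨m, hm⟩, GlobalCenter.cubicPart_eq (GlobalCenter.taylorCoeff (lam 2) m), hm,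
      Nat.mul_div_cancel_left m (by norm_num)]
  · rw [GlobalCenter.M_eq_of_taylorCoeff hlam hlam0 hσ h1 h2 hh, GlobalCenter.cubicCoeff,
      if_neg (c := 3 ∣ n) fun hd => hn hd, zero_mul, add_zero]
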